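/- Let $S\subset\mathbb{R}^3$ be a sphere and let $U\subset S$ be a finite set of $n$ points in general position: no three points of $U$ lie on a common great circle and no four points of $U$ lie on a common circle. Let $k$ be an integer with $1\le k\le n-1$. The order-$k$ spherical Voronoi diagram $SV_k(U)$ is the following. Its open faces are the sets, one for each $P\subset U$ with $|P|=k$, of the points $x\in S$ such that every point of $P$ is strictly nearer to $x$ (in spherical distance) than every point of $U\setminus P$. Its skeleton is the set of the points of $S$ that lie in no open face. Its vertices are the centers of those circles on $S$ that pass through three points of $U$ and enclose exactly $k-1$ or exactly $k-2$ further points of $U$. Its (open) edges are the connected components of the skeleton minus the vertices; the ends of an edge are the points of its closure that are not on it. For $i\in U$ let $R_k(i)$ be the set of the points of $S$ that have $i$ as one of their $k$ nearest points of $U$, and let $B_k(i)$ be the boundary of $R_k(i)$ in $S$. **Theorem.** $SV_k(U)$ has an orientable cycle double cover consisting of the $n=|U|$ cycles $B_k(i)$, $i\in U$, each oriented clockwise (seen from outside $S$) around the point $i$. That is: 1. For every $i\in U$, the set $B_k(i)$ is a simple closed curve contained in the skeleton of $SV_k(U)$, and it has a parametrization $\gamma_i$ as a simple closed curve that runs clockwise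 around $i$. 2. These parametrizations can be chosen such that, in addition, for every edge $e$ of $SV_k(U)$ there are exactly two points $i\ne j$ of $U$ with $e\subset B_k(i)$ and $e\subset B_k(j)$, the edge $e$ is disjoint from all the other curves $B_k(l)$, and $\gamma_i$ and $\gamma_j$ run through $e$ in opposite directions. 3. If $n\ge 3$, then moreover every edge of $SV_k(U)$ has its ends among the vertices, so that $SV_k(U)$ is a (multi)graph; each $\gamma_i$ traces a graph cycle $C_i$ (a cyclic sequence of distinct vertices and distinct edges); the $n$ cycles $C_i$ have pairwise different edge sets; and every edge has two distinct ends and belongs to exactly two of the $C_i$, which traverse it in opposite directions. (For $n=2$ the diagram $SV_1(U)$ is a single great circle without vertices; then 1 and 2 say that it is both $B_1(i)$ and $B_1(j)$, with opposite orientations.) -/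

import Mathlib

open Set Topology

noncomputable section

namespace SphericalVoronoi

/-- Euclidean three-space. -/
abbrev Space : Type := EuclideanSpace ℝ (Fin 3)

/-- The sphere with centre `c` and radius `r` in three-space, as a topological space. -/
abbrev Sph (c : Space) (r : ℝ) : Type := Metric.sphere c r

section Diagram

variable {c : Space} {r : ℝ}

/-- The spherical (great-circle) distance on the sphere of centre `c` and radius `r`. -/
def sphDist (x y : Sph c r) : ℝ := r * EuclideanGeometry.angle (x : Space) c (y : Space)

/-- The circle on the sphere with spherical centre `v` and spherical radius `ρ`. It is a great
circle exactly when `ρ` is a quarter of the circumference of the sphere. -/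
def sphCircle (v : Sph c r) (ρ : ℝ) : Set (Sph c r) := {x | sphDist v x = ρ}

/-- No three points of `U` lie on a great circle and no four points of `U` lie on a circle. -/
structure GeneralPosition (U : Finset (Sph c r)) : Prop where
  great_circle : ∀ v : Sph c r, ((U : Set (Sph c r)) ∩ sphCircle v (Real.pi * r / 2)).ncard ≤ 2
  circle : ∀ (v : Sph c r) (ρ : ℝ), ((U : Set (Sph c r)) ∩ sphCircle v ρ).ncard ≤ 3

/-- The interior of the face associated with `P`: every point of `P` is strictly nearer than every
other point of `U`. -/
def openFace (U P : Finset (Sph c r)) : Set (Sph c r) :=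
  {x | ∀ p ∈ P, ∀ q ∈ U, q ∉ P → sphDist x p < sphDist x q}

/-- The union of the edges and the vertices of the order-`k` diagram: the points of the sphere that
lie in no open face, that is, whose `k` nearest points of `U` are not uniquely determined. -/
def skeleton (U : Finset (Sph c r)) (k : ℕ) : Set (Sph c r) :=
  {x | ¬ ∃ P : Finset (Sph c r), P ⊆ U ∧ P.card = k ∧ x ∈ openFace U P}

/-- `v` is the centre of a circle through three points of `U` that encloses exactly `m` points
of `U`. -/
def IsCentre (U : Finset (Sph c r)) (m : ℕ) (v : Sph c r) : Prop :=
  ∃ ρ : ℝ, ((U : Set (Sph c r)) ∩ sphCircle v ρ).ncard = 3 ∧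
    {p : Sph c r | p ∈ U ∧ sphDist v p < ρ}.ncard = m

/-- The vertices of the order-`k` diagram: centres of circles through three points of `U` that
enclose `k - 1` points (type I) or `k - 2` points (type II) of `U`. -/
def vertices (U : Finset (Sph c r)) (k : ℕ) : Set (Sph c r) :=
  {v | ∃ m : ℕ, IsCentre U m v ∧ (m + 1 = k ∨ m + 2 = k)}

/-- The (open) edges of the order-`k` diagram: the connected components of the skeleton with the
vertices removed. -/
def edges (U : Finset (Sph c r)) (k : ℕ) : Set (Set (Sph c r)) :=
  {e | ∃ x ∈ skeleton U k \ vertices U k, e = connectedComponentIn (skeleton U k \ vertices U k) x}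

/-- The order-`k` spherical Voronoi diagram as a multigraph (parallel edges and loops are allowed):
an open edge `e` joins `x` and `y` if `x` and `y` are the points of its closure not on `e`. -/
def diagram (U : Finset (Sph c r)) (k : ℕ) : Graph (Sph c r) (Set (Sph c r)) where
  vertexSet := vertices U k
  IsLink e x y := e ∈ edges U k ∧ x ∈ vertices U k ∧ y ∈ vertices U k ∧ closure e \ e = {x, y}
  isLink_symm := by
    intro e _
    constructor
    rintro x y ⟨he, hx, hy, h⟩
    exact ⟨he, hy, hx, by rw [h, pair_comm]⟩
  eq_or_eq_of_isLink_of_isLink := by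
    rintro e x y v w ⟨-, -, -, h⟩ ⟨-, -, -, h'⟩
    have hx : x ∈ ({v, w} : Set (Sph c r)) := by
      rw [← h', h]
      exact mem_insert x {y}
    simpa using hx
  left_mem_of_isLink := by
    rintro e x y ⟨-, hx, -, -⟩
    exact hx

/-- The region of all points of the sphere that have `i` as one of their `k` nearest points
of `U`. -/
def region (U : Finset (Sph c r)) (k : ℕ) (i : Sph c r) : Set (Sph c r) :=
  {x | {p : Sph c r | p ∈ U ∧ sphDist x p < sphDist x i}.ncard < k}

/-- The boundary (on the sphere) of the region of `i`. -/
def boundary (U : Finset (Sph c r)) (k : ℕ) (i : Sph c r) : Set (Sph c r) :=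
  frontier (region U k i)

/-- The determinant of the vectors from the centre of the sphere to `x`, `y`, `z`. -/
def orientDet (x y z : Sph c r) : ℝ :=
  Matrix.det (Matrix.of ![fun a => (x : Space) a - c a, fun a => (y : Space) a - c a,
    fun a => (z : Space) a - c a])

/-- The curve `γ` runs clockwise around the point `i`, as seen from outside the sphere: seen from
outside, a short motion from `y` to `z` turns clockwise around `i` exactly when the determinant of
`i`, `y`, `z` is negative. -/
def IsClockwise (i : Sph c r) (γ : ℝ → Sph c r) : Prop :=
  ∀ s : ℝ, ∀ᶠ t in 𝓝[>] s, orientDet i (γ s) (γ t) < 0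

end Diagram

/-- An (oriented, parametrized) simple closed curve of period `1`. -/
structure IsSimpleClosedCurve {X : Type*} [TopologicalSpace X] (γ : ℝ → X) : Prop where
  continuous : Continuous γ
  periodic : Function.Periodic γ 1
  injOn : InjOn γ (Ico 0 1)

/-- The curves `γ` and `δ` run through `e` in opposite directions: near each parameter `s` at which
`γ` is on `e`, the curve `γ` is `δ` with an orientation-reversing change of parameter. -/
def OppositeAlong {X : Type*} (e : Set X) (γ δ : ℝ → X) : Prop :=
  ∀ s t : ℝ, γ s ∈ e → δ t = γ s →
    ∃ ε > 0, ∃ φ : ℝ → ℝ, φ s = t ∧ ContinuousOn φ (Ioo (s - ε) (s + ε)) ∧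
      StrictAntiOn φ (Ioo (s - ε) (s + ε)) ∧ ∀ u ∈ Ioo (s - ε) (s + ε), δ (φ u) = γ u

/-- A cycle in a multigraph with a chosen orientation: a cyclic sequence of distinct vertices and
distinct edges, the edge `edge t` leading from `vert t` to `vert (t + 1)`. -/
structure OrientedCycle {α β : Type*} (G : Graph α β) where
  len : ℕ
  len_pos : 0 < len
  vert : ZMod len → α
  edge : ZMod len → β
  vert_injective : Function.Injective vert
  edge_injective : Function.Injective edge
  isLink : ∀ t, G.IsLink (edge t) (vert t) (vert (t + 1))

/-- The set of edges of a cycle. -/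
def OrientedCycle.edgeSet {α β : Type*} {G : Graph α β} (C : OrientedCycle G) : Set β :=
  range C.edge

/-- The oriented cycle `C` runs through the edge `e` from `x` to `y`. -/
def OrientedCycle.Traverses {α β : Type*} {G : Graph α β} (C : OrientedCycle G)
    (e : β) (x y : α) : Prop :=
  ∃ t, C.edge t = e ∧ C.vert t = x ∧ C.vert (t + 1) = y

/-- A family of oriented cycles is an oriented cycle double cover: every edge belongs to precisely
two of the cycles, and these run through it in opposite directions (between its two distinct
ends). -/
def IsOrientedDoubleCover {ι α β : Type*} {G : Graph α β} (C : ι → OrientedCycle G) : Prop :=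
  ∀ e ∈ G.edgeSet, ∃ i j : ι, i ≠ j ∧ (∀ l, e ∈ (C l).edgeSet ↔ l = i ∨ l = j) ∧
    ∃ x y : α, x ≠ y ∧ (C i).Traverses e x y ∧ (C j).Traverses e y x

/-- The oriented cycle `C`, in a multigraph whose vertices are points and whose edges are sets of
points, is the one that the closed curve `γ` of period `1` runs through: `γ` passes through the
vertices of `C` at successive parameters `σ t`, and through its edges in between. -/
def Traces {X : Type*} {G : Graph X (Set X)} (γ : ℝ → X) (C : OrientedCycle G) : Prop :=
  ∃ σ : ℤ → ℝ, StrictMono σ ∧ (∀ t, σ (t + C.len) = σ t + 1) ∧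
    ∀ t : ℤ, γ (σ t) = C.vert t ∧ γ '' Ioo (σ t) (σ (t + 1)) = C.edge t

end SphericalVoronoi

end

/-!
Only comparisons of distances matter, and `x` is nearer to `p` than to `q` exactly if the inner
product of the vectors from the centre to `x` and `p` exceeds that for `x` and `q`. Call a site `i`
*tied* at `x` (`Tie`) if it can serve both as the `k`-th and as the `(k + 1)`-st nearest site to
`x`. The skeleton consists of the points with a tied site; at each of them at least two
sites are tied, and at most three by general position, with three at the vertices and only there
(`mem_skeleton_iff`, `mem_vertices_iff_three`). The boundary of the region of `i` is the set of
points at which `i` is tied (`boundary_eq`). Being tied is a closed condition, and exactly two sites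
are tied at a point of the skeleton that is not a vertex; so the tied pair is constant along an edge
(`exists_tie_pair`), and an edge lies on exactly two of the boundaries.

The boundary around `i` is understood in polar coordinates with centre `i`. At the point in
direction `w` whose angular distance from `i` has cotangent `h`, a site `p` is nearer than `i`
exactly if `h < ⟪w, q⟫`, where `q` is the stereographic projection of `p` from `i`
(`Frame.ip_polar_lt_iff`).
So the region of `i` is star-shaped, and its boundary is the graph of the `k`-th largest of the
functions `w ↦ ⟪w, q⟫` (`Frame.level`), a continuous function on the circle of directions. This
gives the simple closed curve `Frame.curve`, which runs clockwise as `w` does.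

The functions `⟪w, q⟫` are sinusoids of the same period, and distinct sites have distinct ones. Two
consequences describe the vertices on the curve. The difference of two sinusoids vanishes in every
half-turn, so that with a third site present each half-turn contains a vertex
(`Frame.exists_vertex`); in particular, each boundary has at least two vertices and each of its arcs
between successive vertices, which are exactly the edges on it (`arc_mem_edges`), has two distinct
ends. Moreover the difference is odd around each of its zeros, so that the site tied with `i`
changes at each vertex (`Frame.not_tie_both_sides`); this distinguishes the edge sets of the cycles.

Finally, along the bisector of `i` and `j` the orientation determinants with respect to `i` and `j`
are opposite (`orientDet_eq_neg`), whence the two boundary curves through an edge run through it in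
opposite directions, both locally (`oppositeAlong_curve`) and as steps of graph cycles.
-/

namespace SphericalVoronoi

variable {c : Space} {r : ℝ} {U : Finset (Sph c r)} {k : ℕ}

/-! ### Distances as inner products -/

/-- The inner product of the vectors from the centre of the sphere to `x` and `y`. On a fixed
sphere it is a strictly decreasing function of the spherical distance. -/
noncomputable def ip (x y : Sph c r) : ℝ := inner ℝ ((x : Space) - c) ((y : Space) - c)

theorem norm_sub_centre (x : Sph c r) : ‖(x : Space) - c‖ = r := by
  have := x.2
  rwa [Metric.mem_sphere, dist_eq_norm] at this

theorem ip_self (x : Sph c r) : ip x x = r ^ 2 := by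
  rw [ip, real_inner_self_eq_norm_sq, norm_sub_centre]

theorem sphDist_eq (x y : Sph c r) :
    sphDist x y = r * Real.arccos (ip x y / r ^ 2) := by
  unfold sphDist EuclideanGeometry.angle InnerProductGeometry.angle
  rw [vsub_eq_sub, vsub_eq_sub, norm_sub_centre, norm_sub_centre, ip, sq]

theorem ip_div_mem (hr : 0 < r) (x y : Sph c r) : ip x y / r ^ 2 ∈ Icc (-1 : ℝ) 1 := by
  have h := abs_real_inner_le_norm ((x : Space) - c) ((y : Space) - c)
  rw [norm_sub_centre, norm_sub_centre, ← sq, abs_le] at h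
  have h2 : 0 < r ^ 2 := by positivity
  refine ⟨?_, ?_⟩
  · rw [le_div_iff₀ h2, ip]; linarith [h.1]
  · rw [div_le_iff₀ h2, ip]; linarith [h.2]

theorem sphDist_lt_iff (hr : 0 < r) (x p q : Sph c r) :
    sphDist x p < sphDist x q ↔ ip x q < ip x p := by
  rw [sphDist_eq, sphDist_eq, mul_lt_mul_iff_right₀ hr,
    Real.strictAntiOn_arccos.lt_iff_gt (ip_div_mem hr _ _) (ip_div_mem hr _ _),
    div_lt_div_iff_of_pos_right (by positivity)]

theorem sphDist_eq_iff (hr : 0 < r) (x p q : Sph c r) :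
    sphDist x p = sphDist x q ↔ ip x p = ip x q := by
  have h1 := sphDist_lt_iff hr x p q
  have h2 := sphDist_lt_iff hr x q p
  constructor <;> intro h <;> rw [h] at h1 h2 <;>
    simp only [lt_irrefl, false_iff, iff_false, not_lt] at h1 h2 <;>
    exact le_antisymm (by assumption) (by assumption)

theorem ip_lt_of_ne {x y : Sph c r} (h : x ≠ y) : ip x y < r ^ 2 := by
  have h1 : (x : Space) - c - ((y : Space) - c) ≠ 0 := by
    rw [sub_sub_sub_cancel_right, sub_ne_zero]
    exact fun h' => h (Subtype.ext h')
  have h2 := norm_sub_sq_real ((x : Space) - c) ((y : Space) - c)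
  rw [norm_sub_centre, norm_sub_centre] at h2
  have h3 := norm_pos_iff.2 h1
  unfold ip
  nlinarith

@[fun_prop]
theorem continuous_ip (y : Sph c r) : Continuous fun x : Sph c r => ip x y := by
  unfold ip
  fun_prop

/-! ### Ranks in a finite family of reals -/

/-- A value of rank `k` exists in every finite family with at least `k` members. -/
theorem exists_rank {α : Type*} (S : Finset α) (f : α → ℝ) (hk : 1 ≤ k) (hkS : k ≤ S.card) :
    ∃ p ∈ S, (S.filter fun q => f p < f q).card < k ∧ k ≤ (S.filter fun q => f p ≤ f q).card := by
  classical
  obtain ⟨p0, hp0, hmax⟩ := S.exists_max_image f (Finset.card_pos.1 (by omega))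
  have hA : (S.filter fun p => (S.filter fun q => f p < f q).card < k).Nonempty := by
    refine ⟨p0, Finset.mem_filter.2 ⟨hp0, ?_⟩⟩
    rw [Finset.filter_eq_empty_iff.2 fun q hq => not_lt.2 (hmax q hq)]
    simpa using Nat.lt_of_succ_le hk
  -- The least of the members with fewer than `k` members above them has rank `k`.
  obtain ⟨p, hp, hmin⟩ := Finset.exists_min_image _ f hA
  rw [Finset.mem_filter] at hp
  refine ⟨p, hp.1, hp.2, ?_⟩
  by_contra! hlt
  -- The largest member below `f p` would still have fewer than `k` members above it.
  have hB : (S.filter fun q => f q < f p).Nonempty := by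
    by_contra! hB
    rw [Finset.filter_eq_empty_iff] at hB
    rw [Finset.filter_true_of_mem fun q hq => not_lt.1 (hB hq)] at hlt
    omega
  obtain ⟨q, hq, hqmax⟩ := Finset.exists_max_image _ f hB
  rw [Finset.mem_filter] at hq
  refine absurd (hmin q (Finset.mem_filter.2 ⟨hq.1, lt_of_le_of_lt ?_ hlt⟩)) (not_le.2 hq.2)
  refine Finset.card_le_card fun q' hq' => ?_
  rw [Finset.mem_filter] at hq' ⊢
  refine ⟨hq'.1, ?_⟩
  by_contra! h
  exact absurd (hqmax q' (Finset.mem_filter.2 ⟨hq'.1, h⟩)) (not_le.2 hq'.2)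

/-! ### Ties -/

/-- The site `i` is at the same time the `k`-th and the `(k + 1)`-st nearest site to `x`, for
suitable ways to break ties. -/
def Tie (U : Finset (Sph c r)) (k : ℕ) (x i : Sph c r) : Prop :=
  i ∈ U ∧ (U.filter fun p => ip x i < ip x p).card < k ∧
    k < (U.filter fun p => ip x i ≤ ip x p).card

theorem Tie.ip_le {x i j : Sph c r} (hi : Tie U k x i) (hj : Tie U k x j) : ip x j ≤ ip x i := by
  by_contra! h
  have : (U.filter fun p => ip x j ≤ ip x p).card ≤ (U.filter fun p => ip x i < ip x p).card :=
    Finset.card_le_card (Finset.monotone_filter_right _ fun p _ hp => h.trans_le hp)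
  have := hi.2.1
  have := hj.2.2
  omega

theorem Tie.ip_eq {x i j : Sph c r} (hi : Tie U k x i) (hj : Tie U k x j) : ip x i = ip x j :=
  le_antisymm (hj.ip_le hi) (hi.ip_le hj)

theorem Tie.of_ip_eq {x i j : Sph c r} (hi : Tie U k x i) (hj : j ∈ U) (h : ip x i = ip x j) :
    Tie U k x j := by
  refine ⟨hj, ?_, ?_⟩
  · rw [← h]; exact hi.2.1
  · rw [← h]; exact hi.2.2

theorem card_le_eq (x i : Sph c r) : (U.filter fun p => ip x i ≤ ip x p).card =
    (U.filter fun p => ip x i < ip x p).card + (U.filter fun p => ip x p = ip x i).card := by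
  classical
  rw [← Finset.card_union_of_disjoint]
  · congr 1
    ext p
    simp only [Finset.mem_filter, Finset.mem_union, le_iff_lt_or_eq]
    tauto
  · rw [Finset.disjoint_filter]
    intro p _ h1 h2
    exact absurd h2 h1.ne'

theorem mem_skeleton_iff (hr : 0 < r) (hk : 1 ≤ k) (hkn : k < U.card) (x : Sph c r) :
    x ∈ skeleton U k ↔ ∃ i, Tie U k x i := by
  constructor
  · intro hx
    obtain ⟨i, hi, h1, h2⟩ := exists_rank U (fun p => ip x p) hk hkn.le
    rcases h2.lt_or_eq with h2 | h2
    · exact ⟨i, hi, h1, h2⟩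
    · refine absurd ⟨_, Finset.filter_subset _ _, h2.symm, ?_⟩ hx
      intro p hp q hq hqP
      rw [Finset.mem_filter] at hp hqP
      rw [sphDist_lt_iff hr]
      push Not at hqP
      exact (hqP hq).trans_le hp.2
  · rintro ⟨i, hi⟩ ⟨P, hPU, hPk, hx⟩
    have hx' : ∀ p ∈ P, ∀ q ∈ U, q ∉ P → ip x q < ip x p := fun p hp q hq hqP =>
      (sphDist_lt_iff hr _ _ _).1 (hx p hp q hq hqP)
    by_cases hiP : i ∈ P
    · refine absurd hi.2.2 (not_lt.2 ?_)
      rw [← hPk]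
      refine Finset.card_le_card fun q hq => ?_
      rw [Finset.mem_filter] at hq
      by_contra hqP
      exact absurd (hx' i hiP q hq.1 hqP) (not_lt.2 hq.2)
    · refine absurd hi.2.1 (not_lt.2 ?_)
      rw [← hPk]
      exact Finset.card_le_card fun p hp =>
        Finset.mem_filter.2 ⟨hPU hp, hx' p hp i hi.1 hiP⟩

theorem card_equidistant_le (hr : 0 < r) (hU : GeneralPosition U) (x i : Sph c r) :
    (U.filter fun p => ip x p = ip x i).card ≤ 3 := by
  have := hU.circle x (sphDist x i)
  rw [← Set.ncard_coe_finset]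
  convert this using 2
  ext p
  simp [sphCircle, sphDist_eq_iff hr]

theorem mem_vertices_iff (hr : 0 < r) (x : Sph c r) :
    x ∈ vertices U k ↔ ∃ i, Tie U k x i ∧ (U.filter fun p => ip x p = ip x i).card = 3 := by
  have key : ∀ i, ((U : Set (Sph c r)) ∩ sphCircle x (sphDist x i)).ncard =
      (U.filter fun p => ip x p = ip x i).card := by
    intro i
    rw [← Set.ncard_coe_finset]
    congr 1
    ext p
    simp [sphCircle, sphDist_eq_iff hr]
  have key2 : ∀ i, {p : Sph c r | p ∈ U ∧ sphDist x p < sphDist x i}.ncard =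
      (U.filter fun p => ip x i < ip x p).card := by
    intro i
    rw [← Set.ncard_coe_finset]
    congr 1
    ext p
    simp [sphDist_lt_iff hr]
  constructor
  · rintro ⟨m, ⟨ρ, h3, hm⟩, hmk⟩
    obtain ⟨i, hiU, hi⟩ : ((U : Set (Sph c r)) ∩ sphCircle x ρ).Nonempty :=
      Set.nonempty_of_ncard_ne_zero (by omega)
    obtain rfl : sphDist x i = ρ := hi
    rw [key] at h3
    rw [key2] at hm
    have := card_le_eq (U := U) x i
    exact ⟨i, ⟨hiU, by omega, by omega⟩, h3⟩
  · rintro ⟨i, hi, h3⟩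
    refine ⟨_, ⟨sphDist x i, by rw [key, h3], rfl⟩, ?_⟩
    rw [key2]
    have := card_le_eq (U := U) x i
    have := hi.2.1
    have := hi.2.2
    omega

theorem Tie.exists_ne {x i : Sph c r} (hi : Tie U k x i) : ∃ j, j ≠ i ∧ Tie U k x j := by
  have h1 := card_le_eq (U := U) x i
  have h2 := hi.2.1
  have h3 := hi.2.2
  obtain ⟨j, hj, hji⟩ := Finset.exists_mem_ne (s := U.filter fun p => ip x p = ip x i) (by omega) i
  rw [Finset.mem_filter] at hj
  exact ⟨j, hji, hi.of_ip_eq hj.1 hj.2.symm⟩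

/-- Vertices are the points with three tied sites. -/
theorem mem_vertices_iff_three (hr : 0 < r) (hU : GeneralPosition U) {x i : Sph c r}
    (hi : Tie U k x i) :
    x ∈ vertices U k ↔ ∃ j l, j ≠ i ∧ l ≠ i ∧ j ≠ l ∧ Tie U k x j ∧ Tie U k x l := by
  classical
  rw [mem_vertices_iff hr]
  constructor
  · rintro ⟨i', hi', h3⟩
    rw [hi'.ip_eq hi] at h3
    have hmem : i ∈ U.filter fun p => ip x p = ip x i := Finset.mem_filter.2 ⟨hi.1, rfl⟩
    have h2 : 1 < ((U.filter fun p => ip x p = ip x i).erase i).card := by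
      rw [Finset.card_erase_of_mem hmem, h3]; norm_num
    obtain ⟨j, hj, l, hl, hjl⟩ := Finset.one_lt_card.1 h2
    simp only [Finset.mem_erase, Finset.mem_filter] at hj hl
    exact ⟨j, l, hj.1, hl.1, hjl, hi.of_ip_eq hj.2.1 hj.2.2.symm, hi.of_ip_eq hl.2.1 hl.2.2.symm⟩
  · rintro ⟨j, l, hji, hli, hjl, hj, hl⟩
    refine ⟨i, hi, le_antisymm (card_equidistant_le hr hU x i) ?_⟩
    rw [← Finset.card_eq_three.2 ⟨i, j, l, hji.symm, hli.symm, hjl, rfl⟩]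
    refine Finset.card_le_card fun p hp => ?_
    simp only [Finset.mem_insert, Finset.mem_singleton] at hp
    rcases hp with rfl | rfl | rfl
    · simp [hi.1]
    · simp [hj.1, hj.ip_eq hi]
    · simp [hl.1, hl.ip_eq hi]

/-- At most three sites are tied. -/
theorem Tie.eq_or_eq_or_eq (hr : 0 < r) (hU : GeneralPosition U) {x i j l p : Sph c r}
    (hi : Tie U k x i) (hj : Tie U k x j) (hl : Tie U k x l) (hp : Tie U k x p)
    (hij : i ≠ j) (hil : i ≠ l) (hjl : j ≠ l) : p = i ∨ p = j ∨ p = l := by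
  classical
  by_contra! h
  have h4 : ({i, j, l, p} : Finset (Sph c r)).card = 4 := by
    rw [Finset.card_insert_of_notMem,
      Finset.card_eq_three.2 ⟨j, l, p, hjl, h.2.1.symm, h.2.2.symm, rfl⟩]
    simp [hij, hil, h.1.symm]
  have := card_equidistant_le hr hU x i
  have h5 : ({i, j, l, p} : Finset (Sph c r)).card ≤ (U.filter fun q => ip x q = ip x i).card := by
    refine Finset.card_le_card fun q hq => ?_
    simp only [Finset.mem_insert, Finset.mem_singleton] at hq
    rcases hq with rfl | rfl | rfl | rfl
    · simp [hi.1]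
    · simp [hj.1, hj.ip_eq hi]
    · simp [hl.1, hl.ip_eq hi]
    · simp [hp.1, hp.ip_eq hi]
  omega

/-! ### Polar coordinates around a site -/

/-- A positively oriented orthonormal basis of space whose first vector points from the centre of
the sphere to `i`. -/
structure Frame (i : Sph c r) where
  basis : OrthonormalBasis (Fin 3) ℝ Space
  smul_basis_zero : r • basis 0 = (i : Space) - c
  det_pos : 0 < Matrix.det (Matrix.of fun m a => basis m a)

theorem Frame.nonempty (hr : 0 < r) (i : Sph c r) : Nonempty (Frame i) := by
  set e : Space := r⁻¹ • ((i : Space) - c) with he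
  have hre : r • e = (i : Space) - c := by rw [he, smul_smul, mul_inv_cancel₀ hr.ne', one_smul]
  have hne : ‖e‖ = 1 := by
    rw [he, norm_smul, norm_sub_centre, norm_inv, Real.norm_of_nonneg hr.le, inv_mul_cancel₀ hr.ne']
  have ho : Orthonormal ℝ (({0} : Set (Fin 3)).domRestrict (fun _ : Fin 3 => e)) := by
    constructor
    · intro _; exact hne
    · rintro ⟨a, rfl⟩ ⟨b, rfl⟩ hab; exact absurd rfl hab
  obtain ⟨b, hb⟩ := ho.exists_orthonormalBasis_extension_of_card_eq (by simp)
  have hb0 : b 0 = e := hb 0 rfl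
  have hdet : Matrix.det (Matrix.of fun m a => b m a) ≠ 0 := by
    have hM : (Matrix.of fun m a => b m a) * (Matrix.of fun m a => b m a).transpose = 1 := by
      ext m n
      have := b.inner_eq_ite n m
      simp only [PiLp.inner_apply, RCLike.inner_apply, conj_trivial] at this
      rw [Matrix.mul_apply, Matrix.one_apply]
      simp only [Matrix.of_apply, Matrix.transpose_apply, this, eq_comm]
    intro h
    have := congrArg Matrix.det hM
    rw [Matrix.det_mul, h] at this
    simp at this
  rcases hdet.lt_or_gt with h | h
  · -- Reversing the last vector reverses the orientation.
    have ho' : Orthonormal ℝ ![b 0, b 1, -b 2] := by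
      rw [orthonormal_iff_ite]
      intro m n
      fin_cases m <;> fin_cases n <;> simp
    let b' := (basisOfOrthonormalOfCardEqFinrank ho' (by simp)).toOrthonormalBasis
      (by simp)
    have hb' : ∀ m, b' m = ![b 0, b 1, -b 2] m := fun m => by simp [b']
    refine ⟨⟨b', ?_, ?_⟩⟩
    · rw [hb']; simp [hb0, hre]
    · rw [Matrix.det_fin_three] at h ⊢
      simp only [hb', Matrix.of_apply] at h ⊢
      simp
      linarith
  · exact ⟨⟨b, by rw [hb0, hre], h⟩⟩

namespace Frame

variable {i : Sph c r} (F : Frame i)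

/-- The coordinates of the vector from the centre of the sphere to `x`. -/
noncomputable def coord (m : Fin 3) (x : Sph c r) : ℝ := inner ℝ (F.basis m) ((x : Space) - c)

@[fun_prop]
theorem continuous_coord (m : Fin 3) : Continuous (F.coord m) := by
  unfold coord
  fun_prop

theorem ip_eq (x y : Sph c r) : ip x y = F.coord 0 x * F.coord 0 y + F.coord 1 x * F.coord 1 y +
    F.coord 2 x * F.coord 2 y := by
  unfold ip coord
  rw [← F.basis.sum_inner_mul_inner, Fin.sum_univ_three]
  simp only [real_inner_comm]

theorem sub_eq (x : Sph c r) : (x : Space) - c =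
    F.coord 0 x • F.basis 0 + F.coord 1 x • F.basis 1 + F.coord 2 x • F.basis 2 := by
  conv_lhs => rw [← F.basis.sum_repr' ((x : Space) - c), Fin.sum_univ_three]
  rfl

theorem coord_ext {x y : Sph c r} (h : ∀ m, F.coord m x = F.coord m y) : x = y := by
  apply Subtype.ext
  have := F.sub_eq x
  rw [h, h, h, ← F.sub_eq y] at this
  exact sub_left_injective this

theorem sum_sq (x : Sph c r) : F.coord 0 x ^ 2 + F.coord 1 x ^ 2 + F.coord 2 x ^ 2 = r ^ 2 := by
  rw [← ip_self x, F.ip_eq]; ring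

theorem coord_zero_self : F.coord 0 i = r := by
  unfold coord
  rw [← F.smul_basis_zero, real_inner_smul_right, real_inner_self_eq_norm_sq]
  simp

theorem coord_self_of_ne {m : Fin 3} (hm : m ≠ 0) : F.coord m i = 0 := by
  unfold coord
  rw [← F.smul_basis_zero, real_inner_smul_right, F.basis.inner_eq_zero hm, mul_zero]

theorem ip_self_right (x : Sph c r) : ip x i = r * F.coord 0 x := by
  rw [F.ip_eq, F.coord_zero_self, F.coord_self_of_ne (by decide), F.coord_self_of_ne (by decide)]
  ring

theorem coord_zero_lt (hr : 0 < r) {p : Sph c r} (hp : p ≠ i) : F.coord 0 p < r := by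
  have := ip_lt_of_ne hp
  rw [F.ip_self_right, sq] at this
  exact lt_of_mul_lt_mul_left this hr.le

theorem orientDet_eq (x y : Sph c r) : orientDet i x y =
    r * Matrix.det (Matrix.of fun m a => F.basis m a) *
      (F.coord 1 x * F.coord 2 y - F.coord 2 x * F.coord 1 y) := by
  have hx : ∀ a, (x : Space) a - c a = F.coord 0 x * F.basis 0 a + F.coord 1 x * F.basis 1 a +
      F.coord 2 x * F.basis 2 a := fun a => by
    simpa using congrArg (fun v : Space => v a) (F.sub_eq x)
  have hy : ∀ a, (y : Space) a - c a = F.coord 0 y * F.basis 0 a + F.coord 1 y * F.basis 1 a +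
      F.coord 2 y * F.basis 2 a := fun a => by
    simpa using congrArg (fun v : Space => v a) (F.sub_eq y)
  have hi : ∀ a, (i : Space) a - c a = r * F.basis 0 a := fun a => by
    simpa using congrArg (fun v : Space => v a) F.smul_basis_zero.symm
  unfold orientDet
  simp only [Matrix.det_fin_three, Matrix.of_apply, Matrix.cons_val, hx, hy, hi]
  ring

/-- The point in direction `cos 2πs b₁ - sin 2πs b₂` from `i` whose angular distance from `i` has
the cotangent `h`. The direction turns clockwise as `s` grows. -/
noncomputable def polar (hr : 0 < r) (h s : ℝ) : Sph c r :=
  ⟨c + (r / √(1 + h ^ 2)) • (h • F.basis 0 + Real.cos (2 * Real.pi * s) • F.basis 1 -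
    Real.sin (2 * Real.pi * s) • F.basis 2), by
    have hsq : (0 : ℝ) < 1 + h ^ 2 := by positivity
    rw [mem_sphere_iff_norm, add_sub_cancel_left, norm_smul, Real.norm_of_nonneg (by positivity)]
    have : ‖h • F.basis 0 + Real.cos (2 * Real.pi * s) • F.basis 1 -
        Real.sin (2 * Real.pi * s) • F.basis 2‖ = √(1 + h ^ 2) := by
      rw [eq_comm, Real.sqrt_eq_iff_mul_self_eq hsq.le (norm_nonneg _),
        ← real_inner_self_eq_norm_mul_norm]
      simp only [inner_add_left, inner_add_right, inner_sub_left, inner_sub_right,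
        real_inner_smul_left, real_inner_smul_right, F.basis.inner_eq_ite]
      simp
      nlinarith [Real.sin_sq_add_cos_sq (2 * Real.pi * s)]
    rw [this, div_mul_cancel₀ _ (Real.sqrt_ne_zero'.2 hsq)]⟩

theorem continuous_polar (hr : 0 < r) : Continuous fun q : ℝ × ℝ => F.polar hr q.1 q.2 := by
  unfold polar
  refine Continuous.subtype_mk ?_ _
  have : ∀ q : ℝ × ℝ, √(1 + q.1 ^ 2) ≠ 0 := fun q => by positivity
  fun_prop (disch := exact this _)

theorem coord_zero_polar (hr : 0 < r) (h s : ℝ) :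
    F.coord 0 (F.polar hr h s) = r / √(1 + h ^ 2) * h := by
  simp [coord, polar, inner_add_right, inner_sub_right, real_inner_smul_right, F.basis.inner_eq_ite]

theorem coord_one_polar (hr : 0 < r) (h s : ℝ) :
    F.coord 1 (F.polar hr h s) = r / √(1 + h ^ 2) * Real.cos (2 * Real.pi * s) := by
  simp [coord, polar, inner_add_right, inner_sub_right, real_inner_smul_right, F.basis.inner_eq_ite]

theorem coord_two_polar (hr : 0 < r) (h s : ℝ) :
    F.coord 2 (F.polar hr h s) = -(r / √(1 + h ^ 2) * Real.sin (2 * Real.pi * s)) := by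
  simp [coord, polar, inner_add_right, inner_sub_right, real_inner_smul_right, F.basis.inner_eq_ite]

/-- Every point other than `i` and its antipode has polar coordinates. -/
theorem exists_polar (hr : 0 < r) {x : Sph c r} (hx : F.coord 1 x ≠ 0 ∨ F.coord 2 x ≠ 0) :
    ∃ h s, F.polar hr h s = x := by
  set z : ℂ := ⟨F.coord 1 x, -F.coord 2 x⟩ with hz
  have hz0 : z ≠ 0 := by
    rw [Ne, Complex.ext_iff]
    simp only [hz, Complex.zero_re, Complex.zero_im, neg_eq_zero]
    tauto
  have hn : 0 < ‖z‖ := norm_pos_iff.2 hz0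
  have hn2 : ‖z‖ ^ 2 = F.coord 1 x ^ 2 + F.coord 2 x ^ 2 := by
    rw [← Complex.normSq_eq_norm_sq, Complex.normSq_apply, hz]; ring
  have hs := F.sum_sq x
  have key : r / √(1 + (F.coord 0 x / ‖z‖) ^ 2) = ‖z‖ := by
    have : 1 + (F.coord 0 x / ‖z‖) ^ 2 = (r / ‖z‖) ^ 2 := by
      field_simp
      rw [hn2]; linarith
    rw [this, Real.sqrt_sq (by positivity)]
    field_simp
  have harg : 2 * Real.pi * (Complex.arg z / (2 * Real.pi)) = Complex.arg z := by
    field_simp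
  refine ⟨F.coord 0 x / ‖z‖, Complex.arg z / (2 * Real.pi), F.coord_ext fun m => ?_⟩
  fin_cases m
  · change F.coord 0 _ = F.coord 0 x
    rw [coord_zero_polar, key]; field_simp
  · change F.coord 1 _ = F.coord 1 x
    rw [coord_one_polar, key, harg, Complex.norm_mul_cos_arg]
  · change F.coord 2 _ = F.coord 2 x
    rw [coord_two_polar, key, harg, Complex.norm_mul_sin_arg]; simp [hz]

/-- The linear form `⟪w, q⟫` in the direction `w` with parameter `s`, where `q` is the
stereographic projection of `p` from `i` onto the plane through the centre, with the radius of the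
sphere as the unit of length. -/
noncomputable def height (p : Sph c r) (s : ℝ) : ℝ :=
  (F.coord 1 p * Real.cos (2 * Real.pi * s) - F.coord 2 p * Real.sin (2 * Real.pi * s)) /
    (r - F.coord 0 p)

@[fun_prop]
theorem continuous_height (p : Sph c r) : Continuous (F.height p) := by
  unfold height
  fun_prop

theorem ip_polar_sub (hr : 0 < r) {p : Sph c r} (hp : p ≠ i) (h s : ℝ) :
    ip (F.polar hr h s) p - ip (F.polar hr h s) i =
      r / √(1 + h ^ 2) * (r - F.coord 0 p) * (F.height p s - h) := by
  have := F.coord_zero_lt hr hp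
  have h0 : r - F.coord 0 p ≠ 0 := by linarith
  rw [F.ip_self_right, F.ip_eq, coord_zero_polar, coord_one_polar, coord_two_polar, height]
  field_simp
  ring

theorem scale_pos (hr : 0 < r) (h : ℝ) : 0 < r / √(1 + h ^ 2) := by positivity

/-- A site is closer than `i` exactly if its height exceeds the cotangent of the angular distance
from `i`. -/
theorem ip_polar_lt_iff (hr : 0 < r) {p : Sph c r} (hp : p ≠ i) (h s : ℝ) :
    ip (F.polar hr h s) i < ip (F.polar hr h s) p ↔ h < F.height p s := by
  have h1 := F.coord_zero_lt hr hp
  rw [← sub_pos, F.ip_polar_sub hr hp, mul_pos_iff_of_pos_left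
    (mul_pos (scale_pos hr h) (sub_pos.2 h1)), sub_pos]

theorem ip_polar_eq_iff (hr : 0 < r) {p : Sph c r} (hp : p ≠ i) (h s : ℝ) :
    ip (F.polar hr h s) i = ip (F.polar hr h s) p ↔ h = F.height p s := by
  have h1 := F.coord_zero_lt hr hp
  rw [eq_comm, ← sub_eq_zero, F.ip_polar_sub hr hp, mul_eq_zero, or_iff_right
    (mul_pos (scale_pos hr h) (sub_pos.2 h1)).ne', sub_eq_zero, eq_comm]

theorem height_add_int (p : Sph c r) (s : ℝ) (n : ℤ) : F.height p (s + n) = F.height p s := by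
  unfold height
  rw [show 2 * Real.pi * (s + n) = 2 * Real.pi * s + n * (2 * Real.pi) by ring,
    Real.cos_add_int_mul_two_pi, Real.sin_add_int_mul_two_pi]

theorem height_add_half (p : Sph c r) (s : ℝ) : F.height p (s + 1 / 2) = -F.height p s := by
  unfold height
  rw [show 2 * Real.pi * (s + 1 / 2) = 2 * Real.pi * s + Real.pi by ring,
    Real.cos_add_pi, Real.sin_add_pi]
  ring

/-- The difference of two heights is odd around each of its zeros. -/
theorem height_sub_reflect {p q : Sph c r} {s : ℝ} (h : F.height p s = F.height q s) (u : ℝ) :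
    F.height p (s + u) - F.height q (s + u) = -(F.height p (s - u) - F.height q (s - u)) := by
  have key : ∀ p, F.height p (s + u) + F.height p (s - u) =
      2 * Real.cos (2 * Real.pi * u) * F.height p s := fun p => by
    unfold height
    rw [mul_add, mul_sub, Real.cos_add, Real.cos_sub, Real.sin_add, Real.sin_sub]
    ring
  have h1 := key p
  rw [h, ← key q] at h1
  linarith

/-- Two heights that agree at two parameters less than half a period apart belong to the same site:
stereographic projection is injective. -/
theorem eq_of_height_eq (hr : 0 < r) {p q : Sph c r} (hp : p ≠ i) (hq : q ≠ i) {s u : ℝ}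
    (hu : 0 < u) (hu2 : u < 1 / 2) (hs : F.height p s = F.height q s)
    (hsu : F.height p (s + u) = F.height q (s + u)) : p = q := by
  have hp0 := sub_pos.2 (F.coord_zero_lt hr hp)
  have hq0 := sub_pos.2 (F.coord_zero_lt hr hq)
  set P := r - F.coord 0 p with hP
  set Q := r - F.coord 0 q with hQ
  set A := F.coord 1 p / P - F.coord 1 q / Q with hA
  set B := F.coord 2 p / P - F.coord 2 q / Q with hB
  have hsin : Real.sin (2 * Real.pi * u) ≠ 0 := by
    refine (Real.sin_pos_of_pos_of_lt_pi (by positivity) ?_).ne'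
    nlinarith [Real.pi_pos]
  have e1 : A * Real.cos (2 * Real.pi * s) - B * Real.sin (2 * Real.pi * s) = 0 := by
    rw [hA, hB]; unfold height at hs
    linear_combination hs
  have e2 : A * Real.cos (2 * Real.pi * s + 2 * Real.pi * u) -
      B * Real.sin (2 * Real.pi * s + 2 * Real.pi * u) = 0 := by
    rw [hA, hB]; unfold height at hsu; rw [mul_add] at hsu
    linear_combination hsu
  rw [Real.cos_add, Real.sin_add] at e2
  have e3 : A * Real.sin (2 * Real.pi * s) + B * Real.cos (2 * Real.pi * s) = 0 := by
    apply mul_right_cancel₀ hsin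
    linear_combination -e2 + Real.cos (2 * Real.pi * u) * e1
  have hcs := Real.sin_sq_add_cos_sq (2 * Real.pi * s)
  have hA0 : A = 0 := by
    linear_combination Real.cos (2 * Real.pi * s) * e1 + Real.sin (2 * Real.pi * s) * e3 - A * hcs
  have hB0 : B = 0 := by
    linear_combination Real.cos (2 * Real.pi * s) * e3 - Real.sin (2 * Real.pi * s) * e1 - B * hcs
  have a1 : F.coord 1 p * Q = F.coord 1 q * P := by
    rw [hA, sub_eq_zero, div_eq_div_iff hp0.ne' hq0.ne'] at hA0; exact hA0
  have b1 : F.coord 2 p * Q = F.coord 2 q * P := by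
    rw [hB, sub_eq_zero, div_eq_div_iff hp0.ne' hq0.ne'] at hB0; exact hB0
  have hp2 := F.sum_sq p
  have hq2 := F.sum_sq q
  have p0 : F.coord 0 p = r - P := by rw [hP]; ring
  have q0 : F.coord 0 q = r - Q := by rw [hQ]; ring
  rw [p0] at hp2
  rw [q0] at hq2
  have hPQ : P = Q := by
    have : 2 * r * P * Q * (Q - P) = 0 := by
      linear_combination (-Q ^ 2) * hp2 + P ^ 2 * hq2 + (F.coord 1 p * Q + F.coord 1 q * P) * a1 +
        (F.coord 2 p * Q + F.coord 2 q * P) * b1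
    rcases mul_eq_zero.1 this with h | h
    · exact absurd h (by positivity)
    · linarith
  rw [hPQ] at a1 b1
  refine F.coord_ext fun m => ?_
  fin_cases m
  · change F.coord 0 p = F.coord 0 q
    rw [p0, q0, hPQ]
  · exact mul_right_cancel₀ hq0.ne' a1
  · exact mul_right_cancel₀ hq0.ne' b1

end Frame

/-! ### The boundary curve of a site as a level of heights -/

namespace Frame

variable {i : Sph c r} (F : Frame i)

open scoped Classical in
/-- `y` is the `k`-th largest among the heights of the sites other than `i` in the direction `s`. -/
def IsLevel (U : Finset (Sph c r)) (k : ℕ) (s y : ℝ) : Prop :=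
  (U.filter fun p => p ≠ i ∧ y < F.height p s).card < k ∧
    k ≤ (U.filter fun p => p ≠ i ∧ y ≤ F.height p s).card

/-- The `k`-th largest of the heights of the sites other than `i`, as a function of the direction.
The value is arbitrary if there are fewer than `k` such sites. -/
noncomputable def level (U : Finset (Sph c r)) (k : ℕ) (s : ℝ) : ℝ :=
  Classical.epsilon (F.IsLevel U k s)

theorem isLevel_level (hi : i ∈ U) (hk : 1 ≤ k) (hkn : k < U.card) (s : ℝ) :
    F.IsLevel U k s (F.level U k s) := by
  classical
  apply Classical.epsilon_spec (p := F.IsLevel U k s)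
  obtain ⟨p, -, h1, h2⟩ := exists_rank (U.erase i) (fun p => F.height p s) hk
    (by rw [Finset.card_erase_of_mem hi]; omega)
  refine ⟨F.height p s, ?_, ?_⟩
  · convert h1 using 2
    ext q; simp only [Finset.mem_filter, Finset.mem_erase]; tauto
  · convert h2 using 2
    ext q; simp only [Finset.mem_filter, Finset.mem_erase]; tauto

variable {F} in
theorem IsLevel.le {s y z : ℝ} (hy : F.IsLevel U k s y) (hz : F.IsLevel U k s z) : z ≤ y := by
  classical
  by_contra! h
  have h1 := hz.2.trans (Finset.card_le_card (Finset.monotone_filter_right U fun p _ hp =>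
    (⟨hp.1, h.trans_le hp.2⟩ : p ≠ i ∧ y < F.height p s)))
  have h2 := hy.1
  simp only [ne_eq] at h1 h2
  omega

variable {F} in
theorem IsLevel.eq {s y z : ℝ} (hy : F.IsLevel U k s y) (hz : F.IsLevel U k s z) : y = z :=
  le_antisymm (hz.le hy) (hy.le hz)

theorem tie_polar_iff (hr : 0 < r) (h s : ℝ) :
    Tie U k (F.polar hr h s) i ↔ i ∈ U ∧ F.IsLevel U k s h := by
  classical
  refine and_congr_right fun hi => and_congr ?_ ?_
  · have : (U.filter fun p => ip (F.polar hr h s) i < ip (F.polar hr h s) p) =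
        U.filter fun p => p ≠ i ∧ h < F.height p s := by
      refine Finset.filter_congr fun p _ => ?_
      by_cases hp : p = i
      · simp [hp]
      · rw [F.ip_polar_lt_iff hr hp]; simp [hp]
    rw [this]
  · have : (U.filter fun p => ip (F.polar hr h s) i ≤ ip (F.polar hr h s) p) =
        insert i (U.filter fun p => p ≠ i ∧ h ≤ F.height p s) := by
      ext p
      simp only [Finset.mem_filter, Finset.mem_insert]
      by_cases hp : p = i
      · simp [hp, hi]
      · rw [le_iff_lt_or_eq, F.ip_polar_lt_iff hr hp, F.ip_polar_eq_iff hr hp, ← le_iff_lt_or_eq]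
        simp [hp]
    rw [this, Finset.card_insert_of_notMem (by simp), Nat.lt_succ_iff]

theorem continuous_level (hi : i ∈ U) (hk : 1 ≤ k) (hkn : k < U.card) :
    Continuous (F.level U k) := by
  classical
  rw [continuous_iff_continuousAt]
  intro s
  have hs := F.isLevel_level hi hk hkn s
  rw [ContinuousAt, tendsto_order]
  constructor
  · intro a ha
    -- The `k` heights that are large at `s` stay above `a`.
    have hev : ∀ p ∈ U, ∀ᶠ t in 𝓝 s, F.level U k s ≤ F.height p s → a < F.height p t := by
      intro p _
      by_cases hp : F.level U k s ≤ F.height p s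
      · filter_upwards [(F.continuous_height p).continuousAt.eventually
          (lt_mem_nhds (ha.trans_le hp))] with t ht _ using ht
      · exact Filter.Eventually.of_forall fun t h => absurd h hp
    filter_upwards [(Filter.eventually_all_finset U).2 hev] with t ht
    by_contra! hle
    have h1 := (F.isLevel_level hi hk hkn t).1
    have h2 := hs.2.trans (Finset.card_le_card (Finset.monotone_filter_right U fun p hpU hp =>
      (⟨hp.1, hle.trans_lt (ht p hpU hp.2)⟩ : p ≠ i ∧ F.level U k t < F.height p t)))
    simp only [ne_eq] at h1 h2
    omega
  · intro a ha
    have hev : ∀ p ∈ U, ∀ᶠ t in 𝓝 s, F.height p s ≤ F.level U k s → F.height p t < a := by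
      intro p _
      by_cases hp : F.height p s ≤ F.level U k s
      · filter_upwards [(F.continuous_height p).continuousAt.eventually
          (gt_mem_nhds (hp.trans_lt ha))] with t ht _ using ht
      · exact Filter.Eventually.of_forall fun t h => absurd h hp
    filter_upwards [(Filter.eventually_all_finset U).2 hev] with t ht
    by_contra! hle
    have h1 := hs.1
    have h2 := (F.isLevel_level hi hk hkn t).2.trans
      (Finset.card_le_card (Finset.monotone_filter_right U fun p hpU hp =>
      (⟨hp.1, lt_of_not_ge fun h => absurd (ht p hpU h) (not_lt.2 (hle.trans hp.2))⟩ :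
        p ≠ i ∧ F.level U k s < F.height p s)))
    simp only [ne_eq] at h1 h2
    omega

/-- The boundary curve of the site `i`: in each direction from `i`, the point at which `k` of the
other sites become as close as `i`. -/
noncomputable def curve (hr : 0 < r) (U : Finset (Sph c r)) (k : ℕ) (s : ℝ) : Sph c r :=
  F.polar hr (F.level U k s) s

theorem continuous_curve (hr : 0 < r) (hi : i ∈ U) (hk : 1 ≤ k) (hkn : k < U.card) :
    Continuous (F.curve hr U k) := by
  have h : Continuous fun s => (F.level U k s, s) :=
    (F.continuous_level hi hk hkn).prodMk continuous_id
  change Continuous ((fun q : ℝ × ℝ => F.polar hr q.1 q.2) ∘ fun s => (F.level U k s, s))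
  exact (F.continuous_polar hr).comp h

theorem level_add_int (s : ℝ) (n : ℤ) : F.level U k (s + n) = F.level U k s := by
  unfold level IsLevel
  simp only [height_add_int]

theorem curve_add_int (hr : 0 < r) (s : ℝ) (n : ℤ) :
    F.curve hr U k (s + n) = F.curve hr U k s := by
  apply Subtype.ext
  simp only [curve, polar, level_add_int]
  rw [show 2 * Real.pi * (s + n) = 2 * Real.pi * s + n * (2 * Real.pi) by ring,
    Real.cos_add_int_mul_two_pi, Real.sin_add_int_mul_two_pi]

theorem tie_curve (hr : 0 < r) (hi : i ∈ U) (hk : 1 ≤ k) (hkn : k < U.card) (s : ℝ) :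
    Tie U k (F.curve hr U k s) i :=
  (F.tie_polar_iff hr _ _).2 ⟨hi, F.isLevel_level hi hk hkn s⟩

/-- At a point on the axis through `i`, the other sites are all farther than `i` or all closer. -/
theorem coord_ne_zero_of_tie (hr : 0 < r) (hkn : k < U.card) {x : Sph c r} (hx : Tie U k x i) :
    F.coord 1 x ≠ 0 ∨ F.coord 2 x ≠ 0 := by
  classical
  by_contra! h
  have hs := F.sum_sq x
  have hip : ∀ p, ip x p = F.coord 0 x * F.coord 0 p := fun p => by rw [F.ip_eq, h.1, h.2]; ring
  have h0 : F.coord 0 x = r ∨ F.coord 0 x = -r := by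
    rw [h.1, h.2] at hs
    exact sq_eq_sq_iff_eq_or_eq_neg.1 (by linarith)
  have hlt := fun p (hp : p ≠ i) => F.coord_zero_lt hr hp
  have h1 := hx.2.1
  have h2 := hx.2.2
  rcases h0 with h0 | h0
  · have : (U.filter fun p => ip x i ≤ ip x p) ⊆ {i} := by
      intro p hp
      rw [Finset.mem_filter, hip, hip, h0, F.coord_zero_self] at hp
      rw [Finset.mem_singleton]
      by_contra hpi
      nlinarith [hlt p hpi, hp.2]
    have := Finset.card_le_card this
    rw [Finset.card_singleton] at this
    omega
  · have : U.erase i ⊆ U.filter fun p => ip x i < ip x p := by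
      intro p hp
      rw [Finset.mem_erase] at hp
      rw [Finset.mem_filter, hip, hip, h0, F.coord_zero_self]
      exact ⟨hp.2, by nlinarith [hlt p hp.1]⟩
    have := Finset.card_le_card this
    rw [Finset.card_erase_of_mem hx.1] at this
    omega

theorem range_curve (hr : 0 < r) (hi : i ∈ U) (hk : 1 ≤ k) (hkn : k < U.card) :
    range (F.curve hr U k) = {x | Tie U k x i} := by
  ext x
  constructor
  · rintro ⟨s, rfl⟩
    exact F.tie_curve hr hi hk hkn s
  · intro hx
    obtain ⟨h, s, rfl⟩ := F.exists_polar hr (F.coord_ne_zero_of_tie hr hkn hx)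
    refine ⟨s, ?_⟩
    rw [curve, (F.isLevel_level hi hk hkn s).eq ((F.tie_polar_iff hr h s).1 hx).2]

theorem coord_one_curve (hr : 0 < r) (s : ℝ) : F.coord 1 (F.curve hr U k s) =
    r / √(1 + F.level U k s ^ 2) * Real.cos (2 * Real.pi * s) :=
  F.coord_one_polar hr _ _

theorem coord_two_curve (hr : 0 < r) (s : ℝ) : F.coord 2 (F.curve hr U k s) =
    -(r / √(1 + F.level U k s ^ 2) * Real.sin (2 * Real.pi * s)) :=
  F.coord_two_polar hr _ _

theorem orientDet_curve (hr : 0 < r) (s t : ℝ) : ∃ K > 0,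
    orientDet i (F.curve hr U k s) (F.curve hr U k t) =
      -(K * Real.sin (2 * Real.pi * (t - s))) := by
  refine ⟨r * Matrix.det (Matrix.of fun m a => F.basis m a) * (r / √(1 + F.level U k s ^ 2)) *
    (r / √(1 + F.level U k t ^ 2)), mul_pos (mul_pos (mul_pos hr F.det_pos) (scale_pos hr _))
    (scale_pos hr _), ?_⟩
  rw [F.orientDet_eq, coord_one_curve, coord_one_curve, coord_two_curve, coord_two_curve,
    mul_sub (2 * Real.pi), Real.sin_sub]
  ring

theorem orientDet_curve_neg (hr : 0 < r) {s t : ℝ} (h : s < t) (h' : t < s + 1 / 2) :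
    orientDet i (F.curve hr U k s) (F.curve hr U k t) < 0 := by
  obtain ⟨K, hK, h1⟩ := F.orientDet_curve (U := U) (k := k) hr s t
  rw [h1, neg_lt_zero]
  refine mul_pos hK (Real.sin_pos_of_pos_of_lt_pi (mul_pos (by positivity) (by linarith)) ?_)
  nlinarith [Real.pi_pos]

/-- The direction, measured from the direction `t`, can be recovered by an arctangent in the
half-space around the direction `t`. -/
theorem curve_add_arctan (hr : 0 < r) (hi : i ∈ U) (hk : 1 ≤ k) (hkn : k < U.card) {t : ℝ}
    {x : Sph c r} (hx : Tie U k x i)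
    (hpos : 0 < Real.cos (2 * Real.pi * t) * F.coord 1 x -
      Real.sin (2 * Real.pi * t) * F.coord 2 x) :
    F.curve hr U k (t + Real.arctan (-(Real.sin (2 * Real.pi * t) * F.coord 1 x +
      Real.cos (2 * Real.pi * t) * F.coord 2 x) / (Real.cos (2 * Real.pi * t) * F.coord 1 x -
      Real.sin (2 * Real.pi * t) * F.coord 2 x)) / (2 * Real.pi)) = x := by
  have hx' : x ∈ range (F.curve hr U k) := by rw [F.range_curve hr hi hk hkn]; exact hx
  obtain ⟨v, rfl⟩ := hx'
  have hβ := scale_pos hr (F.level U k v)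
  set β := r / √(1 + F.level U k v ^ 2) with hβ'
  set d := v - t - round (v - t) with hd
  have hd2 : |d| ≤ 1 / 2 := abs_sub_round _
  have hvd : 2 * Real.pi * v = 2 * Real.pi * (t + d) + (round (v - t) : ℤ) * (2 * Real.pi) := by
    rw [hd]; ring
  rw [coord_one_curve, coord_two_curve, ← hβ', hvd, Real.cos_add_int_mul_two_pi,
    Real.sin_add_int_mul_two_pi] at hpos ⊢
  have e1 : Real.cos (2 * Real.pi * t) * (β * Real.cos (2 * Real.pi * (t + d))) -
      Real.sin (2 * Real.pi * t) * -(β * Real.sin (2 * Real.pi * (t + d))) =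
      β * Real.cos (2 * Real.pi * d) := by
    rw [mul_add, Real.cos_add, Real.sin_add]
    linear_combination β * Real.cos (2 * Real.pi * d) * Real.sin_sq_add_cos_sq (2 * Real.pi * t)
  have e2 : -(Real.sin (2 * Real.pi * t) * (β * Real.cos (2 * Real.pi * (t + d))) +
      Real.cos (2 * Real.pi * t) * -(β * Real.sin (2 * Real.pi * (t + d)))) =
      β * Real.sin (2 * Real.pi * d) := by
    rw [mul_add, Real.cos_add, Real.sin_add]
    linear_combination β * Real.sin (2 * Real.pi * d) * Real.sin_sq_add_cos_sq (2 * Real.pi * t)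
  rw [e1] at hpos ⊢
  rw [e2, mul_div_mul_left _ _ hβ.ne', ← Real.tan_eq_sin_div_cos]
  have hcos : 0 < Real.cos (2 * Real.pi * d) := pos_of_mul_pos_right hpos hβ.le
  have habs : |2 * Real.pi * d| < Real.pi / 2 := by
    by_contra! hge
    rw [← Real.cos_abs] at hcos
    refine absurd (Real.cos_nonpos_of_pi_div_two_le_of_le hge ?_) (not_le.2 hcos)
    rw [abs_mul, abs_of_pos Real.two_pi_pos]
    nlinarith [Real.pi_pos]
  rw [abs_lt] at habs
  rw [Real.arctan_tan (by linarith) habs.2]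
  have hv : v = t + 2 * Real.pi * d / (2 * Real.pi) + (round (v - t) : ℤ) := by
    field_simp
    rw [hd]; ring
  conv_rhs => rw [hv]
  rw [curve_add_int]

theorem curve_injOn (hr : 0 < r) : InjOn (F.curve hr U k) (Ico 0 1) := by
  intro s hs t ht hst
  have h1 := congrArg (F.coord 1) hst
  have h2 := congrArg (F.coord 2) hst
  rw [coord_one_curve, coord_one_curve] at h1
  rw [coord_two_curve, coord_two_curve] at h2
  have hβs := scale_pos hr (F.level U k s)
  have hβt := scale_pos hr (F.level U k t)
  set β := r / √(1 + F.level U k s ^ 2)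
  set β' := r / √(1 + F.level U k t ^ 2)
  have hcs := Real.sin_sq_add_cos_sq (2 * Real.pi * s)
  have hct := Real.sin_sq_add_cos_sq (2 * Real.pi * t)
  have hββ : β = β' := by
    have : β ^ 2 = β' ^ 2 := by
      have a1 := congrArg (fun y : ℝ => y ^ 2) h1
      have a2 := congrArg (fun y : ℝ => y ^ 2) h2
      beta_reduce at a1 a2
      rw [mul_pow, mul_pow] at a1
      rw [neg_sq, neg_sq, mul_pow, mul_pow] at a2
      linear_combination a1 + a2 - β ^ 2 * hcs + β' ^ 2 * hct
    exact (sq_eq_sq₀ hβs.le hβt.le).1 this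
  rw [hββ] at h1 h2
  have hc := mul_left_cancel₀ hβt.ne' h1
  have hsn := mul_left_cancel₀ hβt.ne' (neg_injective h2)
  have hone : Real.cos (2 * Real.pi * s - 2 * Real.pi * t) = 1 := by
    rw [Real.cos_sub, hc, hsn]; linarith
  have := (Real.cos_eq_one_iff_of_lt_of_lt (x := 2 * Real.pi * s - 2 * Real.pi * t)
    (by nlinarith [Real.pi_pos, hs.1, ht.2]) (by nlinarith [Real.pi_pos, ht.1, hs.2])).1 hone
  have h3 : 2 * Real.pi * (s - t) = 0 := by linarith
  rcases mul_eq_zero.1 h3 with h | h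
  · exact absurd h (by positivity)
  · linarith

theorem isSimpleClosedCurve_curve (hr : 0 < r) (hi : i ∈ U) (hk : 1 ≤ k) (hkn : k < U.card) :
    IsSimpleClosedCurve (F.curve hr U k) where
  continuous := F.continuous_curve hr hi hk hkn
  periodic s := by simpa using F.curve_add_int hr s 1
  injOn := F.curve_injOn hr

theorem isClockwise_curve (hr : 0 < r) : IsClockwise i (F.curve hr U k) := by
  intro s
  filter_upwards [Ioo_mem_nhdsGT (show s < s + 1 / 2 by linarith)] with t ht
  exact F.orientDet_curve_neg hr ht.1 ht.2

end Frame

/-! ### The boundary of a region -/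

theorem mem_region_iff (hr : 0 < r) (x i : Sph c r) :
    x ∈ region U k i ↔ (U.filter fun p => ip x i < ip x p).card < k := by
  unfold region
  rw [mem_ofPred_eq, ← Set.ncard_coe_finset]
  simp [sphDist_lt_iff hr]

theorem isClosed_region (hr : 0 < r) (i : Sph c r) : IsClosed (region U k i) := by
  rw [← isOpen_compl_iff, isOpen_iff_eventually]
  intro x hx
  rw [mem_compl_iff, mem_region_iff hr, not_lt] at hx
  have hev : ∀ p ∈ U, ∀ᶠ y in 𝓝 x, ip x i < ip x p → ip y i < ip y p := by
    intro p _
    by_cases hp : ip x i < ip x p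
    · filter_upwards [(continuous_ip i).continuousAt.eventually_lt
        (continuous_ip p).continuousAt hp] with y hy _ using hy
    · exact Filter.Eventually.of_forall fun t h => absurd h hp
  filter_upwards [(Filter.eventually_all_finset U).2 hev] with y hy
  rw [mem_compl_iff, mem_region_iff hr, not_lt]
  exact hx.trans (Finset.card_le_card (Finset.monotone_filter_right U fun p hpU hp => hy p hpU hp))

theorem boundary_eq (hr : 0 < r) {i : Sph c r} (hi : i ∈ U) (hkn : k < U.card) :
    boundary U k i = {x | Tie U k x i} := by
  classical
  obtain ⟨F⟩ := Frame.nonempty hr i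
  ext x
  rw [boundary, (isClosed_region hr i).frontier_eq, mem_sdiff, mem_region_iff hr]
  constructor
  · rintro ⟨h1, h2⟩
    refine ⟨hi, h1, lt_of_not_ge fun h3 => h2 ?_⟩
    rw [mem_interior_iff_mem_nhds]
    have hev : ∀ p ∈ U, ∀ᶠ y in 𝓝 x, ip x p < ip x i → ip y p < ip y i := by
      intro p _
      by_cases hp : ip x p < ip x i
      · filter_upwards [(continuous_ip p).continuousAt.eventually_lt
          (continuous_ip i).continuousAt hp] with y hy _ using hy
      · exact Filter.Eventually.of_forall fun t h => absurd h hp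
    filter_upwards [(Filter.eventually_all_finset U).2 hev] with y hy
    rw [mem_region_iff hr]
    refine lt_of_lt_of_le (Finset.card_lt_card ?_) h3
    refine ⟨fun p hp => ?_, fun h => ?_⟩
    · rw [Finset.mem_filter] at hp ⊢
      exact ⟨hp.1, le_of_not_gt fun h => absurd (hy p hp.1 h) (not_lt.2 hp.2.le)⟩
    · have := h (Finset.mem_filter.2 ⟨hi, le_rfl⟩)
      rw [Finset.mem_filter] at this
      exact lt_irrefl _ this.2
  · intro hx
    refine ⟨hx.2.1, fun hint => ?_⟩
    obtain ⟨h, s, rfl⟩ := F.exists_polar hr (F.coord_ne_zero_of_tie hr hkn hx)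
    have hl := ((F.tie_polar_iff hr h s).1 hx).2
    -- Moving away from `i` in the same direction leaves the region at once.
    have htend : Filter.Tendsto (fun y => F.polar hr y s) (𝓝[<] h) (𝓝 (F.polar hr h s)) :=
      ((F.continuous_polar hr).comp (Continuous.prodMk_left s)).continuousAt.tendsto.mono_left
        nhdsWithin_le_nhds
    obtain ⟨y, hy, hyh⟩ := ((htend.eventually (mem_interior_iff_mem_nhds.1 hint)).and
      self_mem_nhdsWithin).exists
    have hy := (mem_region_iff hr _ _).1 hy
    have h2 := hl.2.trans (Finset.card_le_card (Finset.monotone_filter_right U fun p hpU hp =>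
      (F.ip_polar_lt_iff hr hp.1 y s).2 (lt_of_lt_of_le hyh hp.2)))
    omega

theorem isClosed_tie (hr : 0 < r) (hkn : k < U.card) (i : Sph c r) :
    IsClosed {x | Tie U k x i} := by
  by_cases hi : i ∈ U
  · rw [← boundary_eq hr hi hkn]
    exact isClosed_frontier
  · have : {x | Tie U k x i} = ∅ := by
      ext x; simp [Tie, hi]
    rw [this]; exact isClosed_empty

/-! ### Simple closed curves and periodic sequences of parameters -/

namespace IsSimpleClosedCurve

variable {X : Type*} [TopologicalSpace X] {γ : ℝ → X}

theorem add_int (hγ : IsSimpleClosedCurve γ) (s : ℝ) (n : ℤ) : γ (s + n) = γ s := by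
  simpa using hγ.periodic.int_mul n s

theorem image_Ioo_add_int (hγ : IsSimpleClosedCurve γ) (a b : ℝ) (n : ℤ) :
    γ '' Ioo (a + n) (b + n) = γ '' Ioo a b := by
  rw [← image_add_const_Ioo, image_image]
  simp only [hγ.add_int]

theorem exists_int (hγ : IsSimpleClosedCurve γ) {a b : ℝ} (h : γ a = γ b) : ∃ n : ℤ, a = b + n := by
  have h1 : γ (Int.fract a) = γ (Int.fract b) := by
    rw [← hγ.add_int (Int.fract a) ⌊a⌋, ← hγ.add_int (Int.fract b) ⌊b⌋, Int.fract_add_floor,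
      Int.fract_add_floor, h]
  have h2 := hγ.injOn ⟨Int.fract_nonneg a, Int.fract_lt_one a⟩
    ⟨Int.fract_nonneg b, Int.fract_lt_one b⟩ h1
  refine ⟨⌊a⌋ - ⌊b⌋, ?_⟩
  unfold Int.fract at h2
  push_cast
  linarith

theorem eq_of_abs_sub_lt (hγ : IsSimpleClosedCurve γ) {a b : ℝ} (h : γ a = γ b)
    (hab : |a - b| < 1) : a = b := by
  obtain ⟨n, rfl⟩ := hγ.exists_int h
  rw [add_sub_cancel_left, ← Int.cast_abs, ← Int.cast_one, Int.cast_lt, Int.abs_lt_one_iff] at hab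
  simp [hab]

theorem closure_arc [T2Space X] (hγ : IsSimpleClosedCurve γ) {a b : ℝ} (hab : a < b) :
    closure (γ '' Ioo a b) = γ '' Icc a b := by
  apply subset_antisymm
  · exact closure_minimal (image_mono Ioo_subset_Icc_self)
      (isCompact_Icc.image hγ.continuous).isClosed
  · rw [← closure_Ioo hab.ne]
    exact image_closure_subset_closure_image hγ.continuous

theorem closure_arc_diff [T2Space X] (hγ : IsSimpleClosedCurve γ) {a b : ℝ} (hab : a < b)
    (hb : b < a + 1) : closure (γ '' Ioo a b) \ γ '' Ioo a b = {γ a, γ b} := by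
  rw [hγ.closure_arc hab]
  have hinj : InjOn γ (Icc a b) := fun s hs t ht h => hγ.eq_of_abs_sub_lt h
    (abs_sub_lt_iff.2 ⟨by linarith [hs.2, ht.1], by linarith [hs.1, ht.2]⟩)
  rw [← hinj.image_sdiff_subset Ioo_subset_Icc_self, Icc_sdiff_Ioo_same hab.le, image_pair]

/-- A preconnected part of a simple closed curve that avoids the ends of an arc and meets the open
arc is contained in it. -/
theorem subset_arc [T2Space X] (hγ : IsSimpleClosedCurve γ) {a b : ℝ} {e : Set X}
    (he : IsPreconnected e) (heγ : e ⊆ range γ) (hea : γ a ∉ e) (heb : γ b ∉ e)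
    (hne : (e ∩ γ '' Ioo a b).Nonempty) : e ⊆ γ '' Ioo a b := by
  -- The arc and the complementary arc are closed, and they meet in their ends only.
  have hcov : e ⊆ γ '' Icc a b ∪ γ '' Icc b (a + 1) := by
    intro x hx
    obtain ⟨s, rfl⟩ := heγ hx
    have hs : s - ⌊s - a⌋ ∈ Icc a (a + 1) :=
      ⟨by linarith [Int.floor_le (s - a)], by linarith [Int.lt_floor_add_one (s - a)]⟩
    have hγs : γ (s - ⌊s - a⌋) = γ s := by
      simpa [sub_eq_add_neg] using hγ.add_int s (-⌊s - a⌋)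
    rcases le_total (s - ⌊s - a⌋) b with h | h
    · exact Or.inl ⟨_, ⟨hs.1, h⟩, hγs⟩
    · exact Or.inr ⟨_, ⟨h, hs.2⟩, hγs⟩
  have hends : ∀ s ∈ Icc a b, γ s ∈ e → s ∈ Ioo a b := fun s hs hse =>
    ⟨lt_of_le_of_ne hs.1 fun h => hea (h ▸ hse), lt_of_le_of_ne hs.2 fun h => heb (h ▸ hse)⟩
  have hdisj : e ∩ (γ '' Icc a b ∩ γ '' Icc b (a + 1)) = ∅ := by
    rw [eq_empty_iff_forall_notMem]
    rintro x ⟨hxe, ⟨s, hs, rfl⟩, ⟨t, ht, hts⟩⟩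
    have hs' := hends s hs hxe
    have : t = s := by
      refine hγ.eq_of_abs_sub_lt hts (abs_sub_lt_iff.2 ⟨by linarith [hs'.1, ht.2], ?_⟩)
      linarith [hs'.2, ht.1]
    linarith [hs'.2, ht.1]
  have hcl : ∀ a b, IsClosed (γ '' Icc a b) := fun a b =>
    (isCompact_Icc.image hγ.continuous).isClosed
  have hsub : e ⊆ γ '' Icc a b := by
    obtain ⟨x, hxe, s, hs, rfl⟩ := hne
    rcases isPreconnected_closed_iff.1 he _ _ (hcl a b) (hcl b (a + 1)) hcov
      ⟨γ s, hxe, s, Ioo_subset_Icc_self hs, rfl⟩ with h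
    intro y hy
    rcases hcov hy with h1 | h1
    · exact h1
    · have := h ⟨y, hy, h1⟩
      rw [hdisj] at this
      exact absurd this not_nonempty_empty
  intro x hx
  obtain ⟨s, hs, rfl⟩ := hsub hx
  exact ⟨s, hends s hs hx, rfl⟩

end IsSimpleClosedCurve

/-- A nonempty periodic set of reals with finitely many points in a period is the range of an
increasing sequence. -/
theorem exists_strictMono_range {V : Set ℝ} (hV : ∀ s (n : ℤ), s ∈ V → s + n ∈ V)
    (hfin : (V ∩ Ico 0 1).Finite) (hne : V.Nonempty) :
    ∃ N : ℕ, 0 < N ∧ ∃ σ : ℤ → ℝ, StrictMono σ ∧ (∀ t, σ (t + N) = σ t + 1) ∧ range σ = V := by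
  have hfract : ∀ s ∈ V, Int.fract s ∈ hfin.toFinset := fun s hs => by
    rw [hfin.mem_toFinset]
    refine ⟨?_, Int.fract_nonneg s, Int.fract_lt_one s⟩
    simpa [Int.fract, sub_eq_add_neg] using hV s (-⌊s⌋) hs
  set N := hfin.toFinset.card with hN
  have hN0 : 0 < N := by
    obtain ⟨s, hs⟩ := hne
    exact Finset.card_pos.2 ⟨_, hfract s hs⟩
  have hNz : (0 : ℤ) < N := by exact_mod_cast hN0
  set f := hfin.toFinset.orderEmbOfFin hN.symm with hf
  have hfmem : ∀ m, f m ∈ V ∩ Ico 0 1 := fun m =>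
    hfin.mem_toFinset.1 (hfin.toFinset.orderEmbOfFin_mem hN.symm m)
  have hlt : ∀ t : ℤ, (t % N).toNat < N := fun t => by
    have := Int.emod_nonneg t hNz.ne'
    have := Int.emod_lt_of_pos t hNz
    omega
  -- The points of `V` in the period `[0, 1)` in increasing order, continued by translations.
  refine ⟨N, hN0, fun t => f ⟨(t % N).toNat, hlt t⟩ + (t / N : ℤ), ?_, ?_, ?_⟩
  · intro t t' h
    have hq : t / N ≤ t' / N := Int.ediv_le_ediv hNz h.le
    rcases hq.lt_or_eq with hq | hq
    · have h1 := (hfmem ⟨(t % N).toNat, hlt t⟩).2.2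
      have h2 := (hfmem ⟨(t' % N).toNat, hlt t'⟩).2.1
      have h3 : ((t / N : ℤ) : ℝ) + 1 ≤ (t' / N : ℤ) := by exact_mod_cast hq
      simp only
      linarith
    · simp only [hq, add_lt_add_iff_right, OrderEmbedding.lt_iff_lt, Fin.mk_lt_mk]
      have h1 := Int.emod_add_mul_ediv t N
      have h2 := Int.emod_add_mul_ediv t' N
      have h3 := Int.emod_nonneg t hNz.ne'
      rw [hq] at h1
      omega
  · intro t
    have h1 : (t + N) % N = t % N := by simp
    have h2 : (t + N) / N = t / N + 1 := by
      rw [Int.add_ediv_of_dvd_right (dvd_refl _), Int.ediv_self hNz.ne']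
    simp only [h1, h2]
    push_cast
    ring
  · apply subset_antisymm
    · rintro _ ⟨t, rfl⟩
      exact hV _ _ (hfmem _).1
    · intro v hv
      have := hfract v hv
      rw [← Finset.mem_coe, ← hfin.toFinset.range_orderEmbOfFin hN.symm] at this
      obtain ⟨m, hm⟩ := this
      refine ⟨m + N * ⌊v⌋, ?_⟩
      have h1 : ((m : ℤ) + N * ⌊v⌋) % N = m := by
        rw [Int.add_mul_emod_self_left, Int.emod_eq_of_lt (by omega) (by have := m.2; omega)]
      have h2 : ((m : ℤ) + N * ⌊v⌋) / N = ⌊v⌋ := by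
        rw [Int.add_mul_ediv_left _ _ hNz.ne', Int.ediv_eq_zero_of_lt (by omega)
          (by have := m.2; omega), zero_add]
      simp only [h1, h2]
      simp only [Int.toNat_natCast, Fin.eta]
      rw [hf, hm, Int.fract_add_floor]

theorem apply_add_mul {N : ℕ} {σ : ℤ → ℝ} (hσ : ∀ t, σ (t + N) = σ t + 1) (t n : ℤ) :
    σ (t + n * N) = σ t + n := by
  induction n using Int.induction_on with
  | zero => simp
  | succ n ih => rw [add_mul, one_mul, ← add_assoc, hσ, ih]; push_cast; ring
  | pred n ih =>
    have := hσ (t + (-n - 1) * N)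
    rw [show t + (-n - 1) * N + N = t + -n * (N : ℤ) by ring, ih] at this
    push_cast at this ⊢
    linarith

theorem exists_mem_Ico_succ {N : ℕ} {σ : ℤ → ℝ} (hmono : StrictMono σ)
    (hσ : ∀ t, σ (t + N) = σ t + 1) (s : ℝ) : ∃ t, s ∈ Ico (σ t) (σ (t + 1)) := by
  have hmul := fun n => apply_add_mul hσ 0 n
  simp only [zero_add] at hmul
  obtain ⟨t, ht, hmax⟩ := Int.exists_greatest_of_bdd (P := fun t => σ t ≤ s)
    ⟨(⌊s - σ 0⌋ + 1) * N, fun z hz => by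
      by_contra! hlt
      have h1 := hmono hlt
      rw [hmul] at h1
      have h2 := Int.lt_floor_add_one (s - σ 0)
      push_cast at h1
      linarith⟩
    ⟨⌊s - σ 0⌋ * N, by rw [hmul]; linarith [Int.floor_le (s - σ 0)]⟩
  refine ⟨t, ht, ?_⟩
  by_contra! hle
  have := hmax _ hle
  omega

theorem notMem_Ioo_succ {σ : ℤ → ℝ} (hmono : StrictMono σ) (t t' : ℤ) :
    σ t' ∉ Ioo (σ t) (σ (t + 1)) := by
  rintro ⟨h1, h2⟩
  rw [hmono.lt_iff_lt] at h1 h2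
  omega

theorem eq_of_mem_Ioo_succ {σ : ℤ → ℝ} (hmono : StrictMono σ) {t t' : ℤ} {s : ℝ}
    (h : s ∈ Ioo (σ t) (σ (t + 1))) (h' : s ∈ Ioo (σ t') (σ (t' + 1))) : t = t' := by
  have h1 := hmono.lt_iff_lt.1 (h.1.trans h'.2)
  have h2 := hmono.lt_iff_lt.1 (h'.1.trans h.2)
  omega

/-! ### Edges as arcs of boundary curves -/

/-- Off the vertices, these are the points of the skeleton at which `i` is not tied. -/
theorem isClosed_two_ties (hr : 0 < r) (hkn : k < U.card) (i : Sph c r) :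
    IsClosed {x | ∃ j l, j ≠ i ∧ l ≠ i ∧ j ≠ l ∧ Tie U k x j ∧ Tie U k x l} := by
  have : {x | ∃ j l, j ≠ i ∧ l ≠ i ∧ j ≠ l ∧ Tie U k x j ∧ Tie U k x l} =
      ⋃ j ∈ U, ⋃ l ∈ U, {x | (j ≠ i ∧ l ≠ i ∧ j ≠ l) ∧ Tie U k x j ∧ Tie U k x l} := by
    ext x
    simp only [mem_ofPred_eq, mem_iUnion, exists_prop]
    constructor
    · rintro ⟨j, l, h1, h2, h3, hj, hl⟩
      exact ⟨j, hj.1, l, hl.1, ⟨h1, h2, h3⟩, hj, hl⟩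
    · rintro ⟨j, -, l, -, ⟨h1, h2, h3⟩, hj, hl⟩
      exact ⟨j, l, h1, h2, h3, hj, hl⟩
  rw [this]
  refine isClosed_biUnion_finset fun j _ => isClosed_biUnion_finset fun l _ => ?_
  exact isClosed_const.inter ((isClosed_tie hr hkn j).inter (isClosed_tie hr hkn l))

theorem isClosed_vertices (hr : 0 < r) (hU : GeneralPosition U) (hkn : k < U.card) :
    IsClosed (vertices U k) := by
  have : vertices U k = ⋃ i ∈ U, {x | Tie U k x i} ∩
      {x | ∃ j l, j ≠ i ∧ l ≠ i ∧ j ≠ l ∧ Tie U k x j ∧ Tie U k x l} := by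
    ext x
    simp only [mem_iUnion, exists_prop]
    constructor
    · intro hx
      obtain ⟨i, hi, -⟩ := (mem_vertices_iff hr x).1 hx
      exact ⟨i, hi.1, hi, (mem_vertices_iff_three hr hU hi).1 hx⟩
    · rintro ⟨i, -, hi, h⟩
      exact (mem_vertices_iff_three hr hU hi).2 h
  rw [this]
  exact isClosed_biUnion_finset fun i _ =>
    (isClosed_tie hr hkn i).inter (isClosed_two_ties hr hkn i)

/-- The tied sites do not change along a connected part of the skeleton without vertices. -/
theorem tie_of_isPreconnected (hr : 0 < r) (hU : GeneralPosition U) (hk : 1 ≤ k)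
    (hkn : k < U.card) {e : Set (Sph c r)} (he : IsPreconnected e)
    (heE : e ⊆ skeleton U k \ vertices U k) {x i : Sph c r} (hx : x ∈ e) (hi : Tie U k x i) :
    ∀ y ∈ e, Tie U k y i := by
  have hcov : e ⊆ {x | Tie U k x i} ∪
      {x | ∃ j l, j ≠ i ∧ l ≠ i ∧ j ≠ l ∧ Tie U k x j ∧ Tie U k x l} := by
    intro y hy
    by_cases hyi : Tie U k y i
    · exact Or.inl hyi
    · obtain ⟨j, hj⟩ := (mem_skeleton_iff hr hk hkn y).1 (heE hy).1
      obtain ⟨l, hlj, hl⟩ := hj.exists_ne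
      exact Or.inr ⟨j, l, fun h => hyi (h ▸ hj), fun h => hyi (h ▸ hl), hlj.symm, hj, hl⟩
  intro y hy
  rcases hcov hy with h | h
  · exact h
  · obtain ⟨z, hz, h1, h2⟩ := isPreconnected_closed_iff.1 he _ _ (isClosed_tie hr hkn i)
      (isClosed_two_ties hr hkn i) hcov ⟨x, hx, hi⟩ ⟨y, hy, h⟩
    exact absurd ((mem_vertices_iff_three hr hU h1).2 h2) (heE hz).2

theorem subset_of_mem_edges {e : Set (Sph c r)} (he : e ∈ edges U k) :
    e ⊆ skeleton U k \ vertices U k := by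
  obtain ⟨x, -, rfl⟩ := he
  exact connectedComponentIn_subset _ _

theorem isPreconnected_of_mem_edges {e : Set (Sph c r)} (he : e ∈ edges U k) :
    IsPreconnected e := by
  obtain ⟨x, -, rfl⟩ := he
  exact isPreconnected_connectedComponentIn

theorem nonempty_of_mem_edges {e : Set (Sph c r)} (he : e ∈ edges U k) : e.Nonempty := by
  obtain ⟨x, hx, rfl⟩ := he
  exact ⟨x, mem_connectedComponentIn hx⟩

/-- A connected part of the skeleton without vertices that meets an edge is part of it. -/
theorem subset_of_mem_edges_of_inter {e A : Set (Sph c r)} (he : e ∈ edges U k)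
    (hA : IsPreconnected A) (hAE : A ⊆ skeleton U k \ vertices U k) (hne : (A ∩ e).Nonempty) :
    A ⊆ e := by
  obtain ⟨x, hx, rfl⟩ := he
  obtain ⟨y, hyA, hye⟩ := hne
  rw [connectedComponentIn_eq hye]
  exact hA.subset_connectedComponentIn hyA hAE

/-- Along an edge exactly two sites are tied. -/
theorem exists_tie_pair (hr : 0 < r) (hU : GeneralPosition U) (hk : 1 ≤ k)
    (hkn : k < U.card) {e : Set (Sph c r)} (he : e ∈ edges U k) {x i : Sph c r} (hx : x ∈ e)
    (hi : Tie U k x i) : ∃ j, j ≠ i ∧ Tie U k x j ∧ ∀ y ∈ e, ∀ l, Tie U k y l ↔ l = i ∨ l = j := by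
  have hT := fun {x i} => tie_of_isPreconnected (x := x) (i := i) hr hU hk hkn
    (isPreconnected_of_mem_edges he) (subset_of_mem_edges he)
  obtain ⟨j, hji, hj⟩ := hi.exists_ne
  refine ⟨j, hji, hj, fun y hy l => ⟨fun hl => ?_, ?_⟩⟩
  · by_contra! h
    exact (subset_of_mem_edges he hx).2 ((mem_vertices_iff_three hr hU hi).2
      ⟨j, l, hji, h.1, h.2.symm, hj, hT hy hl x hx⟩)
  · rintro (rfl | rfl)
    · exact hT hx hi y hy
    · exact hT hx hj y hy

/-- The part of a boundary curve between two successive vertices is an edge. -/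
theorem arc_mem_edges (hr : 0 < r) (hU : GeneralPosition U) (hk : 1 ≤ k) (hkn : k < U.card)
    {i : Sph c r} {γ : ℝ → Sph c r} (hγ : IsSimpleClosedCurve γ)
    (hγr : range γ = {x | Tie U k x i}) {a b : ℝ} (hab : a < b)
    (hva : γ a ∈ vertices U k) (hvb : γ b ∈ vertices U k)
    (hv : ∀ s ∈ Ioo a b, γ s ∉ vertices U k) : γ '' Ioo a b ∈ edges U k := by
  have hT : ∀ s, Tie U k (γ s) i := fun s => hγr.subset (mem_range_self s)
  have hAE : γ '' Ioo a b ⊆ skeleton U k \ vertices U k := by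
    rintro _ ⟨s, hs, rfl⟩
    exact ⟨(mem_skeleton_iff hr hk hkn _).2 ⟨i, hT s⟩, hv s hs⟩
  have hA : IsPreconnected (γ '' Ioo a b) :=
    isPreconnected_Ioo.image _ hγ.continuous.continuousOn
  obtain ⟨s, hs⟩ := nonempty_Ioo.2 hab
  have hmem : γ s ∈ γ '' Ioo a b := mem_image_of_mem _ hs
  refine ⟨γ s, hAE hmem, ?_⟩
  have he : connectedComponentIn (skeleton U k \ vertices U k) (γ s) ∈ edges U k :=
    ⟨γ s, hAE hmem, rfl⟩
  have hse := mem_connectedComponentIn (hAE hmem)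
  apply subset_antisymm
  · exact hA.subset_connectedComponentIn hmem hAE
  · refine hγ.subset_arc (isPreconnected_of_mem_edges he) ?_
      (fun h => (subset_of_mem_edges he h).2 hva) (fun h => (subset_of_mem_edges he h).2 hvb)
      ⟨γ s, hse, hmem⟩
    rw [hγr]
    exact tie_of_isPreconnected hr hU hk hkn (isPreconnected_of_mem_edges he)
      (subset_of_mem_edges he) hse (hT s)

/-! ### The vertices on a boundary curve -/

namespace Frame

variable {i : Sph c r} (F : Frame i)

theorem tie_curve_iff (hr : 0 < r) (hi : i ∈ U) (hk : 1 ≤ k) (hkn : k < U.card) {j : Sph c r}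
    (hj : j ∈ U) (hji : j ≠ i) (s : ℝ) :
    Tie U k (F.curve hr U k s) j ↔ F.level U k s = F.height j s := by
  have hT := F.tie_curve hr hi hk hkn s
  rw [← F.ip_polar_eq_iff hr hji]
  exact ⟨fun h => hT.ip_eq h, fun h => hT.of_ip_eq hj h⟩

theorem curve_mem_vertices_iff (hr : 0 < r) (hU : GeneralPosition U) (hi : i ∈ U) (hk : 1 ≤ k)
    (hkn : k < U.card) (s : ℝ) : F.curve hr U k s ∈ vertices U k ↔
      ∃ j ∈ U, ∃ l ∈ U, j ≠ i ∧ l ≠ i ∧ j ≠ l ∧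
        F.level U k s = F.height j s ∧ F.level U k s = F.height l s := by
  rw [mem_vertices_iff_three hr hU (F.tie_curve hr hi hk hkn s)]
  constructor
  · rintro ⟨j, l, hji, hli, hjl, hj, hl⟩
    exact ⟨j, hj.1, l, hl.1, hji, hli, hjl, (F.tie_curve_iff hr hi hk hkn hj.1 hji s).1 hj,
      (F.tie_curve_iff hr hi hk hkn hl.1 hli s).1 hl⟩
  · rintro ⟨j, hj, l, hl, hji, hli, hjl, h1, h2⟩
    exact ⟨j, l, hji, hli, hjl, (F.tie_curve_iff hr hi hk hkn hj hji s).2 h1,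
      (F.tie_curve_iff hr hi hk hkn hl hli s).2 h2⟩

/-- If there are at least three sites, then every half-turn of a boundary curve passes a vertex:
otherwise the level would coincide with one height throughout the half-turn, but the difference of
two heights changes sign in it. -/
theorem exists_vertex (hr : 0 < r) (hU : GeneralPosition U) (hi : i ∈ U) (hk : 1 ≤ k)
    (hkn : k < U.card) (h3 : 3 ≤ U.card) (a : ℝ) :
    ∃ s ∈ Icc a (a + 1 / 2), F.curve hr U k s ∈ vertices U k := by
  classical
  by_contra! hv
  have hA : IsPreconnected (F.curve hr U k '' Icc a (a + 1 / 2)) :=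
    isPreconnected_Icc.image _ (F.continuous_curve hr hi hk hkn).continuousOn
  have hAE : F.curve hr U k '' Icc a (a + 1 / 2) ⊆ skeleton U k \ vertices U k := by
    rintro _ ⟨s, hs, rfl⟩
    exact ⟨(mem_skeleton_iff hr hk hkn _).2 ⟨i, F.tie_curve hr hi hk hkn s⟩, hv s hs⟩
  have ha : a ∈ Icc a (a + 1 / 2) := ⟨le_rfl, by linarith⟩
  obtain ⟨j, hji, hj⟩ := (F.tie_curve hr hi hk hkn a).exists_ne
  have hjs := tie_of_isPreconnected hr hU hk hkn hA hAE (mem_image_of_mem _ ha) hj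
  obtain ⟨l, hl⟩ : ((U.erase i).erase j).Nonempty := by
    rw [← Finset.card_pos, Finset.card_erase_of_mem (Finset.mem_erase.2 ⟨hji, hj.1⟩),
      Finset.card_erase_of_mem hi]
    omega
  simp only [Finset.mem_erase] at hl
  have hcont : ContinuousOn (fun s => F.height j s - F.height l s) (uIcc a (a + 1 / 2)) := by
    fun_prop
  have h0 : (0 : ℝ) ∈ uIcc (F.height j a - F.height l a)
      (F.height j (a + 1 / 2) - F.height l (a + 1 / 2)) := by
    rw [height_add_half, height_add_half, mem_uIcc]
    rcases le_total (F.height j a) (F.height l a) with h | h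
    · left; constructor <;> linarith
    · right; constructor <;> linarith
  obtain ⟨s, hs, hs0⟩ := intermediate_value_uIcc hcont h0
  rw [uIcc_of_le (by linarith)] at hs
  refine hv s hs ((F.curve_mem_vertices_iff hr hU hi hk hkn s).2 ⟨j, hj.1, l, hl.2.2, hji, hl.2.1,
    hl.1.symm, ?_, ?_⟩)
  · exact (F.tie_curve_iff hr hi hk hkn hj.1 hji s).1 (hjs _ (mem_image_of_mem _ hs))
  · rw [(F.tie_curve_iff hr hi hk hkn hj.1 hji s).1 (hjs _ (mem_image_of_mem _ hs))]
    simpa [sub_eq_zero] using hs0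

theorem finite_height_eq (hr : 0 < r) {p q : Sph c r} (hp : p ≠ i) (hq : q ≠ i) (hpq : p ≠ q) :
    ({s | F.height p s = F.height q s} ∩ Ico 0 1).Finite := by
  -- Each half period contains at most one zero.
  refine Set.Finite.of_finite_image (f := fun s : ℝ => ⌊2 * s⌋)
    ((finite_Icc (0 : ℤ) 1).subset ?_) ?_
  · rintro _ ⟨s, ⟨-, hs⟩, rfl⟩
    refine ⟨Int.floor_nonneg.2 (by linarith [hs.1]), ?_⟩
    exact Int.lt_add_one_iff.1 (Int.floor_lt.2 (by push_cast; linarith [hs.2]))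
  · have key : ∀ s t : ℝ, F.height p s = F.height q s → F.height p t = F.height q t →
        ⌊2 * s⌋ = ⌊2 * t⌋ → ¬ s < t := by
      intro s t hs ht hst hlt
      refine hpq (F.eq_of_height_eq hr hp hq (sub_pos.2 hlt) ?_ hs (by simpa using ht))
      have h1 := Int.floor_le (2 * s)
      have h2 := Int.lt_floor_add_one (2 * t)
      rw [hst] at h1
      linarith
    rintro s ⟨hs, -⟩ t ⟨ht, -⟩ hst
    exact le_antisymm (not_lt.1 (key t s ht hs hst.symm)) (not_lt.1 (key s t hs ht hst))

theorem finite_vertices (hr : 0 < r) (hU : GeneralPosition U) (hi : i ∈ U) (hk : 1 ≤ k)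
    (hkn : k < U.card) : ({s | F.curve hr U k s ∈ vertices U k} ∩ Ico 0 1).Finite := by
  classical
  refine (U.finite_toSet.biUnion (t := fun p => ⋃ q ∈ U, if p ≠ i ∧ q ≠ i ∧ p ≠ q then
    {s | F.height p s = F.height q s} ∩ Ico 0 1 else ∅) fun p _ => U.finite_toSet.biUnion
    fun q _ => ?_).subset ?_
  · split_ifs with h
    · exact F.finite_height_eq hr h.1 h.2.1 h.2.2
    · exact finite_empty
  · rintro s ⟨hs, hs01⟩
    obtain ⟨p, hp, q, hq, hpi, hqi, hpq, h1, h2⟩ :=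
      (F.curve_mem_vertices_iff hr hU hi hk hkn s).1 hs
    refine mem_biUnion hp (mem_biUnion hq ?_)
    rw [if_pos ⟨hpi, hqi, hpq⟩]
    exact ⟨h1.symm.trans h2, hs01⟩

/-- The other site tied along a boundary curve changes at each vertex: if the height of `j` were
the `k`-th largest on both sides, then the height of the third site `l`, which is exceeded by that
of `j` on one side only, would have to be at the same time above and below it. -/
theorem not_tie_both_sides (hr : 0 < r) (hU : GeneralPosition U) (hi : i ∈ U) (hk : 1 ≤ k)
    (hkn : k < U.card) {s δ : ℝ} (hs : F.curve hr U k s ∈ vertices U k) (hδ : 0 < δ)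
    {j : Sph c r} (hji : j ≠ i) (h1 : ∀ u ∈ Ioo 0 δ, Tie U k (F.curve hr U k (s - u)) j)
    (h2 : ∀ u ∈ Ioo 0 δ, Tie U k (F.curve hr U k (s + u)) j) : False := by
  classical
  have hjU : j ∈ U := (h1 (δ / 2) ⟨by linarith, by linarith⟩).1
  have hT := fun {p} (hp : p ∈ U) (hpi : p ≠ i) s => F.tie_curve_iff hr hi hk hkn hp hpi s
  have hcl := (F.continuous_level hi hk hkn)
  have hjs : F.level U k s = F.height j s := by
    have hc : Filter.Tendsto (fun u => F.level U k u - F.height j u) (𝓝[>] s)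
        (𝓝 (F.level U k s - F.height j s)) :=
      (hcl.sub (F.continuous_height j)).continuousAt.tendsto.mono_left nhdsWithin_le_nhds
    have h0 : Filter.Tendsto (fun u => F.level U k u - F.height j u) (𝓝[>] s) (𝓝 0) := by
      refine tendsto_const_nhds.congr' ?_
      filter_upwards [Ioo_mem_nhdsGT (show s < s + δ by linarith)] with u hu
      have := (hT hjU hji _).1 (h2 (u - s) ⟨by linarith [hu.1], by linarith [hu.2]⟩)
      rw [add_sub_cancel] at this
      rw [this, sub_self]
    exact sub_eq_zero.1 (tendsto_nhds_unique hc h0)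
  obtain ⟨l, hlU, hli, hlj, hls⟩ : ∃ l ∈ U, l ≠ i ∧ l ≠ j ∧ F.level U k s = F.height l s := by
    obtain ⟨p, hp, q, hq, hpi, hqi, hpq, e1, e2⟩ :=
      (F.curve_mem_vertices_iff hr hU hi hk hkn s).1 hs
    by_cases hpj : p = j
    · exact ⟨q, hq, hqi, fun h => hpq (hpj.trans h.symm), e2⟩
    · exact ⟨p, hp, hpi, hpj, e1⟩
  have hother : ∀ p ∈ U, p ≠ i → p ≠ j → p ≠ l → F.level U k s ≠ F.height p s := by
    intro p hp hpi hpj hpl h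
    rcases Tie.eq_or_eq_or_eq hr hU (F.tie_curve hr hi hk hkn s) ((hT hjU hji s).2 hjs)
      ((hT hlU hli s).2 hls) ((hT hp hpi s).2 h) hji.symm hli.symm hlj.symm with h | h | h
    · exact hpi h
    · exact hpj h
    · exact hpl h
  have hev : ∀ p ∈ U, ∀ᶠ t in 𝓝 s, (F.level U k s < F.height p s → F.level U k t < F.height p t) ∧
      (F.height p s < F.level U k s → F.height p t < F.level U k t) := by
    intro p _
    rcases lt_trichotomy (F.level U k s) (F.height p s) with h | h | h
    · filter_upwards [hcl.continuousAt.eventually_lt (F.continuous_height p).continuousAt h]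
        with t ht using ⟨fun _ => ht, fun h' => absurd h' h.not_gt⟩
    · exact Filter.Eventually.of_forall fun t =>
        ⟨fun h' => absurd h h'.ne, fun h' => absurd h h'.ne'⟩
    · filter_upwards [(F.continuous_height p).continuousAt.eventually_lt hcl.continuousAt h]
        with t ht using ⟨fun h' => absurd h' h.not_gt, fun _ => ht⟩
  obtain ⟨ε, hε, hball⟩ := Metric.eventually_nhds_iff.1 ((Filter.eventually_all_finset U).2 hev)
  -- The sites above the level at `s` stay above it, and those below it stay below it, nearby.
  set A := U.filter fun p => p ≠ i ∧ F.level U k s < F.height p s with hA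
  have hlow : ∀ t, dist t s < ε → F.height l t < F.height j t → F.level U k t = F.height j t →
      k ≤ A.card + 1 := by
    intro t ht hlt hjt
    refine (F.isLevel_level hi hk hkn t).2.trans
      ((Finset.card_le_card fun p hp => ?_).trans (Finset.card_insert_le j A))
    rw [Finset.mem_filter] at hp
    rw [Finset.mem_insert]
    by_cases hpj : p = j
    · exact Or.inl hpj
    · refine Or.inr (Finset.mem_filter.2 ⟨hp.1, hp.2.1, lt_of_le_of_ne (not_lt.1 fun h =>
        absurd ((hball ht p hp.1).2 h) (not_lt.2 hp.2.2)) (hother p hp.1 hp.2.1 hpj ?_)⟩)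
      rintro rfl
      linarith [hp.2.2]
  have hhigh : ∀ t, dist t s < ε → F.height j t < F.height l t → F.level U k t = F.height j t →
      A.card + 1 < k := by
    intro t ht hlt hjt
    have hlA : l ∉ A := fun h => absurd hls (Finset.mem_filter.1 h).2.2.ne
    rw [← Finset.card_insert_of_notMem hlA]
    refine (Finset.card_le_card fun p hp => ?_).trans_lt (F.isLevel_level hi hk hkn t).1
    rw [Finset.mem_insert] at hp
    rw [Finset.mem_filter]
    rcases hp with rfl | hp
    · exact ⟨hlU, hli, hjt ▸ hlt⟩
    · rw [Finset.mem_filter] at hp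
      exact ⟨hp.1, hp.2.1, (hball ht p hp.1).1 hp.2.2⟩
  obtain ⟨u, hu0, hu⟩ := exists_between (lt_min (lt_min hδ hε) (by norm_num : (0 : ℝ) < 1 / 2))
  rw [lt_min_iff, lt_min_iff] at hu
  have hd1 : dist (s + u) s < ε := by
    rw [Real.dist_eq, add_sub_cancel_left, abs_of_pos hu0]; exact hu.1.2
  have hd2 : dist (s - u) s < ε := by
    rw [Real.dist_eq, sub_sub_cancel_left, abs_neg, abs_of_pos hu0]; exact hu.1.2
  have e1 := (hT hjU hji _).1 (h1 u ⟨hu0, hu.1.1⟩)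
  have e2 := (hT hjU hji _).1 (h2 u ⟨hu0, hu.1.1⟩)
  have hrefl := F.height_sub_reflect (hjs.symm.trans hls) u
  rcases lt_trichotomy (F.height j (s + u)) (F.height l (s + u)) with h | h | h
  · have h' := hhigh _ hd1 h e2
    have h'' := hlow _ hd2 (by linarith) e1
    omega
  · exact hlj (F.eq_of_height_eq hr hji hli hu0 hu.2 (hjs.symm.trans hls) h).symm
  · have h' := hhigh _ hd2 (by linarith) e1
    have h'' := hlow _ hd1 h e2
    omega

end Frame

/-! ### Orientation -/

theorem ip_eq_sum (x y : Sph c r) :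
    ip x y = ∑ a, ((x : Space) a - c a) * ((y : Space) a - c a) := by
  simp only [ip, PiLp.inner_apply, RCLike.inner_apply, conj_trivial, PiLp.sub_apply, mul_comm]

/-- Along the bisector of `i` and `j`, clockwise around `i` is counterclockwise around `j`: the
vectors to `x` and `y` and the sum of the vectors to `i` and `j` all lie in the plane orthogonal to
`i - j`. -/
theorem orientDet_eq_neg {i j x y : Sph c r} (hij : i ≠ j) (hx : ip x i = ip x j)
    (hy : ip y i = ip y j) : orientDet j x y = -orientDet i x y := by
  have hdet : Matrix.det (Matrix.of ![fun a => ((i : Space) a - c a) + ((j : Space) a - c a),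
      fun a => (x : Space) a - c a, fun a => (y : Space) a - c a]) = 0 := by
    rw [← Matrix.exists_mulVec_eq_zero_iff]
    refine ⟨fun a => (i : Space) a - (j : Space) a, fun h => hij ?_, ?_⟩
    · refine Subtype.ext (PiLp.ext fun a => ?_)
      simpa [sub_eq_zero] using congrFun h a
    · have hii := ip_self i
      rw [← ip_self j] at hii
      rw [ip_eq_sum, ip_eq_sum, Fin.sum_univ_three, Fin.sum_univ_three] at hx hy hii
      ext m
      fin_cases m <;> simp [Matrix.mulVec, dotProduct, Fin.sum_univ_three] <;> linarith
  unfold orientDet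
  simp only [Matrix.det_fin_three, Matrix.of_apply, Matrix.cons_val] at hdet ⊢
  linarith

/-- The change of parameter is the angle around `j` of the point of the boundary curve of `i`. -/
theorem oppositeAlong_curve (hr : 0 < r) (hU : GeneralPosition U) (hk : 1 ≤ k) (hkn : k < U.card)
    {i j : Sph c r} (F : Frame i) (G : Frame j) (hij : i ≠ j) (hi : i ∈ U) (hj : j ∈ U)
    {e : Set (Sph c r)} (he : e ∈ edges U k) (hej : ∀ y ∈ e, Tie U k y j) :
    OppositeAlong e (F.curve hr U k) (G.curve hr U k) := by
  intro s t hs hst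
  have hγ := F.continuous_curve hr hi hk hkn
  set γ := F.curve hr U k with hγdef
  set D : Sph c r → ℝ := fun x =>
    Real.cos (2 * Real.pi * t) * G.coord 1 x - Real.sin (2 * Real.pi * t) * G.coord 2 x with hD
  set N : Sph c r → ℝ := fun x =>
    -(Real.sin (2 * Real.pi * t) * G.coord 1 x + Real.cos (2 * Real.pi * t) * G.coord 2 x) with hN
  have hDc : Continuous D := by fun_prop
  have hNc : Continuous N := by fun_prop
  have hDt : 0 < D (γ s) := by
    have h := Frame.scale_pos hr (G.level U k t)
    simp only [hD, ← hst, Frame.coord_one_curve, Frame.coord_two_curve]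
    have := Real.sin_sq_add_cos_sq (2 * Real.pi * t)
    convert h using 1
    linear_combination (r / √(1 + G.level U k t ^ 2)) * this
  have hNt : N (γ s) = 0 := by
    simp only [hN, ← hst, Frame.coord_one_curve, Frame.coord_two_curve]
    ring
  have hopen : IsOpen {u | γ u ∉ vertices U k ∧ 0 < D (γ u)} :=
    ((isClosed_vertices hr hU hkn).isOpen_compl.preimage hγ).inter
      (isOpen_lt continuous_const (hDc.comp hγ))
  obtain ⟨ε', hε', hball⟩ := Metric.isOpen_iff.1 hopen s ⟨(subset_of_mem_edges he hs).2, hDt⟩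
  rw [Real.ball_eq_Ioo] at hball
  set ε := min ε' (1 / 4) with hε
  have hε0 : 0 < ε := lt_min hε' (by norm_num)
  have hIoo : Ioo (s - ε) (s + ε) ⊆ Ioo (s - ε') (s + ε') :=
    Ioo_subset_Ioo (by linarith [min_le_left ε' (1 / 4)]) (by linarith [min_le_left ε' (1 / 4)])
  have hs0 : s ∈ Ioo (s - ε) (s + ε) := ⟨by linarith, by linarith⟩
  have hTj : ∀ u ∈ Ioo (s - ε) (s + ε), Tie U k (γ u) j := by
    have : γ '' Ioo (s - ε) (s + ε) ⊆ e := by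
      refine subset_of_mem_edges_of_inter he (isPreconnected_Ioo.image _ hγ.continuousOn) ?_
        ⟨γ s, mem_image_of_mem _ hs0, hs⟩
      rintro _ ⟨u, hu, rfl⟩
      exact ⟨(mem_skeleton_iff hr hk hkn _).2 ⟨i, F.tie_curve hr hi hk hkn u⟩,
        (hball (hIoo hu)).1⟩
    exact fun u hu => hej _ (this (mem_image_of_mem _ hu))
  set φ : ℝ → ℝ := fun u => t + Real.arctan (N (γ u) / D (γ u)) / (2 * Real.pi) with hφ
  have hδφ : ∀ u ∈ Ioo (s - ε) (s + ε), G.curve hr U k (φ u) = γ u := fun u hu =>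
    G.curve_add_arctan hr hj hk hkn (hTj u hu) (hball (hIoo hu)).2
  have hφt : ∀ u, |φ u - t| < 1 / 4 := fun u => by
    have h1 := Real.neg_pi_div_two_lt_arctan (N (γ u) / D (γ u))
    have h2 := Real.arctan_lt_pi_div_two (N (γ u) / D (γ u))
    simp only [hφ]
    rw [add_sub_cancel_left, abs_lt, lt_div_iff₀ Real.two_pi_pos, div_lt_iff₀ Real.two_pi_pos]
    constructor <;> linarith
  refine ⟨ε, hε0, φ, ?_, ?_, ?_, hδφ⟩
  · simp [hφ, hNt]
  · refine continuousOn_const.add (ContinuousOn.div_const (Real.continuous_arctan.comp_continuousOn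
      ((hNc.comp hγ).continuousOn.div (hDc.comp hγ).continuousOn fun u hu => ?_)) _)
    exact (hball (hIoo hu)).2.ne'
  · intro u hu v hv huv
    have h1 := F.orientDet_curve_neg (U := U) (k := k) hr huv
      (by linarith [hu.1, hv.2, min_le_right ε' (1 / 4)])
    have h2 := orientDet_eq_neg hij ((F.tie_curve hr hi hk hkn u).ip_eq (hTj u hu))
      ((F.tie_curve hr hi hk hkn v).ip_eq (hTj v hv))
    rw [← hγdef, ← hδφ u hu, ← hδφ v hv] at h1 h2
    by_contra! hle
    rcases hle.eq_or_lt with heq | hlt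
    · rw [heq] at h1
      obtain ⟨K, -, hK⟩ := G.orientDet_curve (U := U) (k := k) hr (φ v) (φ v)
      rw [heq, hK, sub_self] at h2
      simp only [mul_zero, Real.sin_zero, neg_zero] at h2
      linarith
    · have a1 := abs_lt.1 (hφt u)
      have a2 := abs_lt.1 (hφt v)
      have := G.orientDet_curve_neg (U := U) (k := k) hr hlt (by linarith)
      linarith

/-! ### The cycle of a site -/

theorem edges_eq_of_inter {e e' : Set (Sph c r)} (he : e ∈ edges U k) (he' : e' ∈ edges U k)
    (h : (e ∩ e').Nonempty) : e = e' :=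
  subset_antisymm
    (subset_of_mem_edges_of_inter he' (isPreconnected_of_mem_edges he) (subset_of_mem_edges he) h)
    (subset_of_mem_edges_of_inter he (isPreconnected_of_mem_edges he') (subset_of_mem_edges he')
      (inter_comm e e' ▸ h))

/-- A simple closed curve that passes alternately through the vertices and the edges of the diagram
traces a cycle. -/
theorem exists_cycle {γ : ℝ → Sph c r} (hγ : IsSimpleClosedCurve γ) {N : ℕ} (hN : 0 < N)
    {σ : ℤ → ℝ} (hmono : StrictMono σ) (hσ : ∀ t, σ (t + N) = σ t + 1)
    (hlink : ∀ t, (diagram U k).IsLink (γ '' Ioo (σ t) (σ (t + 1))) (γ (σ t)) (γ (σ (t + 1)))) :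
    ∃ C : OrientedCycle (diagram U k), (∀ t, σ (t + C.len) = σ t + 1) ∧
      ∀ t : ℤ, γ (σ t) = C.vert t ∧ γ '' Ioo (σ t) (σ (t + 1)) = C.edge t := by
  have hmul := apply_add_mul hσ
  have hcast : ∀ t : ℤ, ∃ n : ℤ, (((t : ZMod N).cast : ℤ)) = t + n * N := fun t => by
    refine ⟨-(t / N), ?_⟩
    rw [ZMod.coe_intCast]
    linarith [Int.emod_add_mul_ediv t N, mul_comm (N : ℤ) (t / N)]
  have hv : ∀ t : ℤ, γ (σ ((t : ZMod N).cast : ℤ)) = γ (σ t) := fun t => by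
    obtain ⟨n, hn⟩ := hcast t
    rw [hn, hmul, hγ.add_int]
  have he : ∀ t : ℤ, γ '' Ioo (σ ((t : ZMod N).cast : ℤ)) (σ (((t : ZMod N).cast : ℤ) + 1)) =
      γ '' Ioo (σ t) (σ (t + 1)) := fun t => by
    obtain ⟨n, hn⟩ := hcast t
    rw [hn, add_right_comm, hmul, hmul, hγ.image_Ioo_add_int]
  refine ⟨⟨N, hN, fun z => γ (σ (z.cast : ℤ)),
    fun z => γ '' Ioo (σ (z.cast : ℤ)) (σ ((z.cast : ℤ) + 1)), ?_, ?_, ?_⟩, hσ,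
    fun t => ⟨(hv t).symm, (he t).symm⟩⟩
  · intro z z' h
    obtain ⟨n, hn⟩ := hγ.exists_int h
    rw [← hmul] at hn
    have := congrArg (fun t : ℤ => (t : ZMod N)) (hmono.injective hn)
    simpa using this
  · intro z z' h
    obtain ⟨s, hs⟩ := nonempty_Ioo.2 (hmono (lt_add_one (z.cast : ℤ)))
    have hmem : γ s ∈ γ '' Ioo (σ (z'.cast : ℤ)) (σ ((z'.cast : ℤ) + 1)) :=
      (Set.ext_iff.1 h (γ s)).1 (mem_image_of_mem γ hs)
    obtain ⟨s', hs', hss⟩ := hmem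
    obtain ⟨n, rfl⟩ := hγ.exists_int hss.symm
    have : s' + n ∈ Ioo (σ ((z'.cast : ℤ) + n * N)) (σ ((z'.cast : ℤ) + n * N + 1)) := by
      rw [add_right_comm, hmul, hmul]
      exact ⟨by linarith [hs'.1], by linarith [hs'.2]⟩
    have := congrArg (fun t : ℤ => (t : ZMod N)) (eq_of_mem_Ioo_succ hmono hs this)
    simpa using this
  · intro z
    obtain ⟨t, rfl⟩ : ∃ t : ℤ, (t : ZMod N) = z := ⟨z.cast, by simp⟩
    have h1 := hv (t + 1)
    push_cast at h1
    simp only [he, hv, h1]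
    exact hlink t

namespace Frame

variable {i : Sph c r} (F : Frame i)

/-- The increasing sequence of the parameters at which a boundary curve passes a vertex. -/
theorem exists_vertex_sequence (hr : 0 < r) (hU : GeneralPosition U) (hi : i ∈ U) (hk : 1 ≤ k)
    (hkn : k < U.card) (h3 : 3 ≤ U.card) :
    ∃ N : ℕ, 0 < N ∧ ∃ σ : ℤ → ℝ, StrictMono σ ∧ (∀ t, σ (t + N) = σ t + 1) ∧
      range σ = {s | F.curve hr U k s ∈ vertices U k} ∧ ∀ t, σ (t + 1) ≤ σ t + 1 / 2 := by
  obtain ⟨s, -, hs⟩ := F.exists_vertex hr hU hi hk hkn h3 0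
  obtain ⟨N, hN, σ, hmono, hσ, hσr⟩ := exists_strictMono_range
    (V := {s | F.curve hr U k s ∈ vertices U k})
    (fun s n hs => by rw [mem_ofPred_eq, F.curve_add_int]; exact hs)
    (F.finite_vertices hr hU hi hk hkn) ⟨s, hs⟩
  refine ⟨N, hN, σ, hmono, hσ, hσr, fun t => ?_⟩
  by_contra! hlt
  obtain ⟨s, hs, hsv⟩ := F.exists_vertex hr hU hi hk hkn h3 ((σ t + (σ (t + 1) - 1 / 2)) / 2)
  obtain ⟨t', rfl⟩ : s ∈ range σ := hσr ▸ hsv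
  exact notMem_Ioo_succ hmono t t' ⟨by linarith [hs.1], by linarith [hs.2]⟩

/-- The boundary curve of a site traces a cycle, with at most a half-turn around the site inside
each edge. -/
theorem exists_cycle (hr : 0 < r) (hU : GeneralPosition U) (hi : i ∈ U) (hk : 1 ≤ k)
    (hkn : k < U.card) (h3 : 3 ≤ U.card) :
    ∃ C : OrientedCycle (diagram U k), ∃ σ : ℤ → ℝ, StrictMono σ ∧
      (∀ t, σ (t + C.len) = σ t + 1) ∧
      (∀ t : ℤ, F.curve hr U k (σ t) = C.vert t ∧
        F.curve hr U k '' Ioo (σ t) (σ (t + 1)) = C.edge t) ∧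
      range σ = {s | F.curve hr U k s ∈ vertices U k} ∧ ∀ t, σ (t + 1) ≤ σ t + 1 / 2 := by
  obtain ⟨N, hN, σ, hmono, hσ, hσr, hgap⟩ := F.exists_vertex_sequence hr hU hi hk hkn h3
  have hγ := F.isSimpleClosedCurve_curve hr hi hk hkn
  have hv : ∀ t, F.curve hr U k (σ t) ∈ vertices U k := fun t => hσr.subset (mem_range_self t)
  obtain ⟨C, h1, h2⟩ := SphericalVoronoi.exists_cycle (U := U) (k := k) hγ hN hmono hσ fun t => by
    refine ⟨arc_mem_edges hr hU hk hkn hγ (F.range_curve hr hi hk hkn) (hmono (lt_add_one t))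
      (hv t) (hv (t + 1)) fun s hs hsv => ?_, hv t, hv (t + 1),
      hγ.closure_arc_diff (hmono (lt_add_one t)) (by linarith [hgap t])⟩
    obtain ⟨t', rfl⟩ : s ∈ range σ := hσr ▸ hsv
    exact notMem_Ioo_succ hmono t t' hs
  exact ⟨C, σ, hmono, h1, h2, hσr, hgap⟩

end Frame

end SphericalVoronoi

open SphericalVoronoi in
theorem mainTheorem4 (c : SphericalVoronoi.Space) (r : ℝ) (hr : 0 < r)
    (U : Finset (SphericalVoronoi.Sph c r)) (hU : SphericalVoronoi.GeneralPosition U)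
    (k : ℕ) (hk : 1 ≤ k) (hkn : k < U.card) :
    ∃ γ : U → ℝ → SphericalVoronoi.Sph c r,
      -- the boundaries are simple closed curves in the diagram, oriented clockwise
      (∀ i : U, SphericalVoronoi.IsSimpleClosedCurve (γ i) ∧
        range (γ i) = SphericalVoronoi.boundary U k i ∧
        range (γ i) ⊆ SphericalVoronoi.skeleton U k ∧
        SphericalVoronoi.IsClockwise (i : SphericalVoronoi.Sph c r) (γ i)) ∧
      -- every edge lies on precisely two of them, which run through it in opposite directions
      (∀ e ∈ SphericalVoronoi.edges U k, ∃ i j : U, i ≠ j ∧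
        e ⊆ range (γ i) ∧ e ⊆ range (γ j) ∧
        (∀ l : U, l ≠ i → l ≠ j → Disjoint e (range (γ l))) ∧
        SphericalVoronoi.OppositeAlong e (γ i) (γ j)) ∧
      -- if there are at least three points, then the diagram is a graph (all edges have ends), and
      -- these curves are distinct graph cycles that form an oriented cycle double cover
      (3 ≤ U.card →
        (SphericalVoronoi.diagram U k).edgeSet = SphericalVoronoi.edges U k ∧
        ∃ C : U → SphericalVoronoi.OrientedCycle (SphericalVoronoi.diagram U k),
          (∀ i : U, SphericalVoronoi.Traces (γ i) (C i)) ∧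
          Function.Injective (fun i : U => (C i).edgeSet) ∧
          SphericalVoronoi.IsOrientedDoubleCover C) := by
  have F : ∀ i : Sph c r, Frame i := fun i => (Frame.nonempty hr i).some
  have hrange : ∀ i : U, range ((F i).curve hr U k) = {x | Tie U k x i} := fun i =>
    (F i).range_curve hr i.2 hk hkn
  have hpair : ∀ e ∈ edges U k, ∃ i j : U, i ≠ j ∧
      ∀ y ∈ e, ∀ l, Tie U k y l ↔ l = i ∨ l = j := by
    intro e he
    obtain ⟨x, hx⟩ := nonempty_of_mem_edges he
    obtain ⟨i, hi⟩ := (mem_skeleton_iff hr hk hkn x).1 (subset_of_mem_edges he hx).1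
    obtain ⟨j, hji, hj, h⟩ := exists_tie_pair hr hU hk hkn he hx hi
    exact ⟨⟨i, hi.1⟩, ⟨j, hj.1⟩, fun h => hji (congrArg Subtype.val h).symm, h⟩
  refine ⟨fun i => (F i).curve hr U k, fun i => ⟨(F i).isSimpleClosedCurve_curve hr i.2 hk hkn,
    ?_, ?_, (F i).isClockwise_curve hr⟩, ?_, fun h3 => ?_⟩
  · rw [hrange, boundary_eq hr i.2 hkn]
  · rw [hrange]
    exact fun x hx => (mem_skeleton_iff hr hk hkn x).2 ⟨i, hx⟩
  · intro e he
    obtain ⟨i, j, hij, h⟩ := hpair e he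
    refine ⟨i, j, hij, ?_, ?_, fun l hli hlj => ?_, ?_⟩
    · rw [hrange]
      exact fun y hy => (h y hy i).2 (Or.inl rfl)
    · rw [hrange]
      exact fun y hy => (h y hy j).2 (Or.inr rfl)
    · rw [hrange, Set.disjoint_left]
      intro y hy hyl
      rcases (h y hy l).1 hyl with h | h
      · exact hli (Subtype.ext h)
      · exact hlj (Subtype.ext h)
    · exact oppositeAlong_curve hr hU hk hkn (F i) (F j) (fun h => hij (Subtype.ext h)) i.2 j.2 he
        fun y hy => (h y hy j).2 (Or.inr rfl)
  · choose C σ hmono hσ hC hσr hgap using fun i : U => (F i).exists_cycle hr hU i.2 hk hkn h3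
    have hCe : ∀ i t, (C i).edge t ∈ edges U k := fun i t => ((C i).isLink t).1
    -- The cycle of each site that is tied along an edge runs through the edge.
    have hmem : ∀ e ∈ edges U k, ∀ i : U, ∀ x ∈ e, Tie U k x i → ∃ t : ℤ, e = (C i).edge t := by
      intro e he i x hx hi
      obtain ⟨s, rfl⟩ : x ∈ range ((F i).curve hr U k) := by rw [hrange]; exact hi
      obtain ⟨t, ht⟩ := exists_mem_Ico_succ (hmono i) (hσ i) s
      refine ⟨t, edges_eq_of_inter he (hCe i t) ⟨_, hx, ?_⟩⟩
      rw [← (hC i t).2]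
      refine mem_image_of_mem _ ⟨lt_of_le_of_ne ht.1 ?_, ht.2⟩
      rintro rfl
      exact (subset_of_mem_edges he hx).2 ((hσr i).subset (mem_range_self t))
    have hmem' : ∀ e (i : U), e ∈ (C i).edgeSet → ∀ y ∈ e, Tie U k y i := by
      rintro _ i ⟨z, rfl⟩ y hy
      obtain ⟨t, rfl⟩ : ∃ t : ℤ, (t : ZMod (C i).len) = z := ⟨z.cast, by simp⟩
      rw [← (hC i t).2] at hy
      obtain ⟨s, -, rfl⟩ := hy
      exact (F i).tie_curve hr i.2 hk hkn s
    have hedge : (diagram U k).edgeSet = edges U k := by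
      ext e
      rw [Graph.edge_mem_iff_exists_isLink]
      constructor
      · rintro ⟨x, y, h⟩
        exact h.1
      · intro he
        obtain ⟨i, j, -, h⟩ := hpair e he
        obtain ⟨x, hx⟩ := nonempty_of_mem_edges he
        obtain ⟨t, rfl⟩ := hmem e he i x hx ((h x hx i).2 (Or.inl rfl))
        exact ⟨_, _, (C i).isLink t⟩
    refine ⟨hedge, C, fun i => ⟨σ i, hmono i, hσ i, hC i⟩, ?_, ?_⟩
    · intro i j hij
      by_contra hne
      -- Otherwise `j` would be tied along both edges at the vertex with parameter `σ i 1`.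
      have hj : ∀ t : ℤ, ∀ s ∈ Ioo (σ i t) (σ i (t + 1)), Tie U k ((F i).curve hr U k s) j := by
        intro t s hs
        refine hmem' ((C i).edge t) j ?_ _ ?_
        · rw [← show (C i).edgeSet = (C j).edgeSet from hij]
          exact mem_range_self _
        · rw [← (hC i t).2]
          exact mem_image_of_mem _ hs
      have h01 := hmono i (zero_lt_one (α := ℤ))
      have h12 := hmono i (one_lt_two (α := ℤ))
      refine (F i).not_tie_both_sides hr hU i.2 hk hkn (s := σ i 1)
        (δ := min (σ i 1 - σ i 0) (σ i 2 - σ i 1)) ((hσr i).subset (mem_range_self 1))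
        (lt_min (by linarith) (by linarith)) (j := j) (fun h => hne (Subtype.ext h.symm)) ?_ ?_
      · rintro u ⟨hu0, hu⟩
        rw [lt_min_iff] at hu
        exact hj 0 _ ⟨by linarith, by simpa using hu0⟩
      · rintro u ⟨hu0, hu⟩
        rw [lt_min_iff] at hu
        exact hj 1 _ ⟨by linarith, by norm_num; linarith⟩
    · intro e he
      rw [hedge] at he
      obtain ⟨i, j, hij, h⟩ := hpair e he
      have hij' : (i : Sph c r) ≠ j := fun h => hij (Subtype.ext h)
      obtain ⟨x, hx⟩ := nonempty_of_mem_edges he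
      refine ⟨i, j, hij, fun l => ⟨fun hl => ?_, fun hl => ?_⟩, ?_⟩
      · simpa only [Subtype.ext_iff] using (h x hx l).1 (hmem' e l hl x hx)
      · obtain ⟨t, rfl⟩ := hmem e he l x hx
          ((h x hx l).2 (by simpa only [Subtype.ext_iff] using hl))
        exact mem_range_self _
      · obtain ⟨t, ht⟩ := hmem e he i x hx ((h x hx i).2 (Or.inl rfl))
        obtain ⟨t', ht'⟩ := hmem e he j x hx ((h x hx j).2 (Or.inr rfl))
        have hlink := ((C i).isLink t).2.2.2
        have hlink' := ((C j).isLink t').2.2.2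
        rw [← ht] at hlink
        rw [← ht', hlink] at hlink'
        have hvt := (hC i t).1
        have hvt1 : (F i).curve hr U k (σ i (t + 1)) = (C i).vert (t + 1) := by
          simpa using (hC i (t + 1)).1
        have hvt' := (hC j t').1
        have hne : (C i).vert t ≠ (C i).vert (t + 1) := by
          rw [← hvt, ← hvt1]
          intro heq
          have hlt := hmono i (lt_add_one t)
          refine hlt.ne (((F i).isSimpleClosedCurve_curve hr i.2 hk hkn).eq_of_abs_sub_lt heq ?_)
          rw [abs_sub_comm, abs_of_pos (sub_pos.2 hlt)]
          linarith [hgap i t]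
        -- Starting from the same end, both curves would run clockwise around both sites.
        have hstart : (C i).vert t ≠ (C j).vert t' := by
          intro heq
          obtain ⟨v, hv⟩ := nonempty_Ioo.2 (hmono j (lt_add_one t'))
          have hz : (F j).curve hr U k v ∈ e := by
            rw [ht', ← (hC j t').2]; exact mem_image_of_mem _ hv
          have hz' := hz
          rw [ht, ← (hC i t).2] at hz'
          obtain ⟨u, hu, huv⟩ := hz'
          have d1 := (F i).orientDet_curve_neg (U := U) (k := k) hr hu.1
            (by linarith [hu.2, hgap i t])
          have d2 := (F j).orientDet_curve_neg (U := U) (k := k) hr hv.1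
            (by linarith [hv.2, hgap j t'])
          have d3 := orientDet_eq_neg (x := (C i).vert t) (y := (F j).curve hr U k v) hij'
            (Tie.ip_eq (U := U) (k := k) (hvt ▸ (F i).tie_curve hr i.2 hk hkn _)
              (heq ▸ hvt' ▸ (F j).tie_curve hr j.2 hk hkn _))
            (Tie.ip_eq ((h _ hz i).2 (Or.inl rfl)) ((h _ hz j).2 (Or.inr rfl)))
          rw [hvt, huv] at d1
          rw [hvt', ← heq] at d2
          linarith
        -- So the ends of the edge appear in opposite order in the two cycles.
        have e1 : (C i).vert t ∈ ({(C j).vert t', (C j).vert (t' + 1)} : Set (Sph c r)) :=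
          hlink' ▸ mem_insert _ _
        have e2 : (C i).vert (t + 1) ∈ ({(C j).vert t', (C j).vert (t' + 1)} : Set (Sph c r)) :=
          hlink' ▸ mem_insert_of_mem _ rfl
        have e1' := e1.resolve_left hstart
        have e2' := e2.resolve_right fun h => hne (e1'.trans h.symm)
        exact ⟨_, _, hne, ⟨t, ht.symm, rfl, rfl⟩, ⟨t', ht'.symm, e2'.symm, e1'.symm⟩⟩
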